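/- Let $n\ge 1$. Let $L^\infty_c$ be the space of real-valued bounded measurable functions on $\mathbb R^n$ with compact support. Let $K$ be a real-valued measurable kernel on $\mathbb R^n\times\mathbb R^n\setminus\{(x,x):x\in\mathbb R^n\}$ (jointly, and in each variable when the other is fixed), and let $K^*(x,y)=K(y,x)$. Let $T$ be a linear operator mapping $L^\infty_c$ to locally integrable functions (functions being identified if they agree almost everywhere) such that for every $f\in L^\infty_c$ and a.e. $x\notin\operatorname{supp} f$, $$Tf(x)=\int_{\mathbb R^n}K(x,y)f(y)\,dy,$$ where the integral converges absolutely. Let $T^*$ be the transpose of $T$, that is, $T^*$ maps $L^\infty_c$ to locally integrable functions and $\int_{\mathbb R^n}(Tf)\,g\,dx=\int_{\mathbb R^n} f\,(T^*g)\,dx$ for all $f,g\in L^\infty_c$. By a cube we mean a cube of positive side length with sides parallel to the axes; $aQ$ is the cube with the same center as $Q$ and side length $a$ times that of $Q$, and $|\cdot|$ is Lebesgue measure. For $1\le r\le\infty$, $\frac1r+\frac1{r'}=1$, let $H_r$ be the class of kernels $K$ satisfying $$\sup_Q\ \sup_{x,x'\in\frac12Q}\ \sum_{k=1}^\infty|2^kQ|^{1/r'}\,\|K(x,\cdot)-K(x',\cdot)\|_{L^r(2^kQ\setminus2^{k-1}Q)}<\infty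 .$$ Assume that $K\in H_r$ for some $1<r\le\infty$ and that $K^*\in H_1$. Then $T$ extends to a bounded linear operator from $L^2(\mathbb R^n)$ to itself if and only if there exists $C>0$ such that for every cube $Q$ and every measurable set $E\subset Q$, $$\int_Q|T^*\chi_E|\,dx\le C|Q|.$$ -/

import Mathlib

open MeasureTheory
open scoped ENNReal NNReal

namespace SparseT1

/-- The closed axis-parallel cube in `ℝⁿ` with centre `c` and side length `l`.
For `a > 0`, its concentric dilate `aQ` is `cube c (a * l)`. -/
def cube {n : ℕ} (c : Fin n → ℝ) (l : ℝ) : Set (Fin n → ℝ) :=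
  {x | ∀ i, |x i - c i| ≤ l / 2}

/-- Lebesgue measurability of a kernel: jointly in both variables, and in each variable separately
when the other one is fixed. All three requirements are up to null sets, so that the values
of `K` on the diagonal play no role (when `n ≥ 1`). -/
structure IsMeasurableKernel {n : ℕ} (K : (Fin n → ℝ) → (Fin n → ℝ) → ℝ) : Prop where
  joint : AEStronglyMeasurable (Function.uncurry K) (volume.prod volume)
  left : ∀ x, AEStronglyMeasurable (fun y => K x y) volume
  right : ∀ y, AEStronglyMeasurable (fun x => K x y) volume

/-- The `L^r`-Hörmander condition (the class `H_r`), `1 ≤ r ≤ ∞`: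
`sup_Q sup_{x, x' ∈ Q/2} ∑_{k ≥ 1} |2^k Q|^{1/r'} ‖K(x,·) - K(x',·)‖_{L^r(2^k Q \ 2^{k-1} Q)} < ∞`,
where `1/r' = 1 - 1/r`. The index `k` of the sum below is shifted by one. -/
def HormanderClass {n : ℕ} (r : ℝ≥0∞) (K : (Fin n → ℝ) → (Fin n → ℝ) → ℝ) : Prop :=
  ∃ A : ℝ≥0, ∀ (c : Fin n → ℝ) (l : ℝ), 0 < l →
    ∀ x ∈ cube c (2⁻¹ * l), ∀ x' ∈ cube c (2⁻¹ * l),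
      ∑' k : ℕ, volume (cube c (2 ^ (k + 1) * l)) ^ (1 - (r⁻¹).toReal) *
        eLpNorm (fun y => K x y - K x' y) r
          (volume.restrict (cube c (2 ^ (k + 1) * l) \ cube c (2 ^ k * l))) ≤ A

/-- Membership in `L^∞_c`: (essentially) bounded functions with compact support. -/
structure IsLinftyc {n : ℕ} (f : (Fin n → ℝ) → ℝ) : Prop where
  memLp_top : MemLp f ∞ volume
  compact : HasCompactSupport f

theorem IsLinftyc.memLp_two {n : ℕ} {f : (Fin n → ℝ) → ℝ} (hf : IsLinftyc f) :
    MemLp f 2 volume :=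
  hf.memLp_top.mono_exponent_of_measure_support_ne_top (s := tsupport f)
    (fun _ hx => image_eq_zero_of_notMem_tsupport hx)
    hf.compact.isCompact.measure_lt_top.ne le_top

/-- `T` is a linear operator from `L^∞_c` to the locally integrable functions, where functions
are identified if they agree almost everywhere. The values of `T` outside
`L^∞_c` are irrelevant. -/
structure IsLinearOperator {n : ℕ} (T : ((Fin n → ℝ) → ℝ) → ((Fin n → ℝ) → ℝ)) : Prop where
  congr : ∀ f g, IsLinftyc f → IsLinftyc g → f =ᵐ[volume] g → T f =ᵐ[volume] T g
  add : ∀ f g, IsLinftyc f → IsLinftyc g → T (f + g) =ᵐ[volume] T f + T g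
  smul : ∀ (a : ℝ) (f), IsLinftyc f → T (a • f) =ᵐ[volume] a • T f
  locallyIntegrable : ∀ f, IsLinftyc f → LocallyIntegrable (T f) volume

/-- `T f (x) = ∫ K(x,y) f(y) dy`, with an absolutely convergent integral, for all `f ∈ L^∞_c` and
(almost) all `x` outside the support of `f`. -/
def IsRepresentedBy {n : ℕ} (T : ((Fin n → ℝ) → ℝ) → ((Fin n → ℝ) → ℝ))
    (K : (Fin n → ℝ) → (Fin n → ℝ) → ℝ) : Prop :=
  ∀ f, IsLinftyc f → ∀ᵐ x ∂(volume : Measure (Fin n → ℝ)), x ∉ tsupport f →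
    Integrable (fun y => K x y * f y) volume ∧ T f x = ∫ y, K x y * f y

/-- `Tstar` is the transpose of `T`: it maps `L^∞_c` to the locally integrable functions and
`∫ (T f) g = ∫ f (Tstar g)` for all `f, g ∈ L^∞_c`. This determines `Tstar g` up to
a null set. -/
structure IsTranspose {n : ℕ} (T Tstar : ((Fin n → ℝ) → ℝ) → ((Fin n → ℝ) → ℝ)) : Prop where
  locallyIntegrable : ∀ g, IsLinftyc g → LocallyIntegrable (Tstar g) volume
  duality : ∀ f g, IsLinftyc f → IsLinftyc g → ∫ x, T f x * g x = ∫ x, f x * Tstar g x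

/-- `T`, given on `L^∞_c`, has an extension to a bounded linear operator of `L²(ℝⁿ)`
to itself. -/
def HasBoundedL2Extension {n : ℕ} (T : ((Fin n → ℝ) → ℝ) → ((Fin n → ℝ) → ℝ)) : Prop :=
  ∃ S : Lp ℝ 2 (volume : Measure (Fin n → ℝ)) →L[ℝ] Lp ℝ 2 (volume : Measure (Fin n → ℝ)),
    ∀ (f : (Fin n → ℝ) → ℝ) (hf : IsLinftyc f), S (hf.memLp_two.toLp f) =ᵐ[volume] T f

end SparseT1

namespace SparseT1

open Set Filter Topology

variable {n : ℕ}

/-! Sufficiency. By duality the testing condition bounds `∫_E T f` for `f` bounded and supported in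
`Q` and for every measurable `E ⊆ Q`. Taking for `E` the two sign sets of `T f` gives `∫_Q |T f| ≲
‖f‖_∞ |Q|` (`locallyTested_of_indicator`). Since `H_r ⊆ H_1`, both `K` and `K*` satisfy the `L¹`
Hörmander condition. Splitting a bounded `h` into its parts inside and outside `2Q` then shows that
`T h` and `T* h`, integrated against a mean-zero function on `Q` bounded by `α`, give at most a
constant times `‖h‖_∞ α |Q|` (`LocallyTested.atomBound`). This is the `L^∞ → BMO` bound for `T` and
`T*`, in dual form.

The `L²` bound comes from a multiscale Calderón–Zygmund decomposition, with no interpolation.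
Rescale so that `‖f‖₂²` and `‖h‖₂²` are at most `L^n`, with supports in a box of side `2L`. Let
`f_k`, `h_k` be the good parts at height `2^k`. They are `O(2^k)`, and `f_{k+1} - f_k` lives on `Ω_k
= {M_d f > 2^k}`, with mean zero on each maximal dyadic cube of `Ω_k`. Telescoping, `⟨T f, h⟩ = ⟨T
f_0, h_0⟩ + Σ_k (⟨T(f_{k+1} - f_k), h_{k+1}⟩ + ⟨T f_k, h_{k+1} - h_k⟩)`. The first term is
controlled by local testing on the box. The atom bounds control the `k`-th summand by `4^k` times
the measures of the level sets of `f` and `h`, and `Σ_k 4^k |Ω_k| ≲ ‖f‖₂²` by the weak type estimate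
for `M_d` (`sum_four_pow_mul_volume_le`). The form is therefore bounded on `L²`
(`abs_pairing_le_of_normalized`), and density gives the extension.

Necessity is Cauchy–Schwarz, after testing `T* χ_E` against its sign on `Q`. -/

theorem cube_eq_closedBall (c : Fin n → ℝ) {l : ℝ} (hl : 0 ≤ l) :
    cube c l = Metric.closedBall c (l / 2) := by
  ext x
  rw [Metric.mem_closedBall, dist_pi_le_iff (by positivity)]
  simp [cube, Real.dist_eq]

theorem volume_cube (c : Fin n → ℝ) {l : ℝ} (hl : 0 ≤ l) :
    volume (cube c l) = ENNReal.ofReal (l ^ n) := by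
  rw [cube_eq_closedBall c hl, Real.volume_pi_closedBall c (by positivity), Fintype.card_fin,
    mul_div_cancel₀ l two_ne_zero]

theorem toReal_volume_cube (c : Fin n → ℝ) {l : ℝ} (hl : 0 ≤ l) :
    (volume (cube c l)).toReal = l ^ n := by
  rw [volume_cube c hl, ENNReal.toReal_ofReal (by positivity)]

theorem isCompact_cube (c : Fin n → ℝ) {l : ℝ} (hl : 0 ≤ l) : IsCompact (cube c l) := by
  rw [cube_eq_closedBall c hl]
  exact isCompact_closedBall _ _

theorem measurableSet_cube (c : Fin n → ℝ) {l : ℝ} (hl : 0 ≤ l) : MeasurableSet (cube c l) :=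
  (isCompact_cube c hl).measurableSet

/-! ### Dyadic grid and averages over its cells. -/

/-- The position of `x` in the grid of half-open cubes of side length `L / 2 ^ j`. -/
noncomputable def dyadicIndex (L : ℝ) (j : ℕ) (x : Fin n → ℝ) : Fin n → ℤ :=
  fun i => ⌊2 ^ j * (x i / L)⌋

/-- The half-open cube of side length `L / 2 ^ j` with position `v`. -/
noncomputable def dyadicCell (L : ℝ) (j : ℕ) (v : Fin n → ℤ) : Set (Fin n → ℝ) :=
  dyadicIndex L j ⁻¹' {v}

theorem measurable_dyadicIndex (L : ℝ) (j : ℕ) :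
    Measurable (dyadicIndex L j : (Fin n → ℝ) → Fin n → ℤ) := by
  refine measurable_pi_lambda _ fun i => Int.measurable_floor.comp ?_
  fun_prop

theorem measurableSet_dyadicCell (L : ℝ) (j : ℕ) (v : Fin n → ℤ) :
    MeasurableSet (dyadicCell L j v) :=
  measurable_dyadicIndex L j (measurableSet_singleton v)

theorem self_mem_dyadicCell (L : ℝ) (j : ℕ) (x : Fin n → ℝ) :
    x ∈ dyadicCell L j (dyadicIndex L j x) := rfl

/-- The coarse index is a function of the fine one, because `⌊t⌋ = ⌊2t⌋ / 2` with integer division.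
Hence the cells are nested. -/
theorem dyadicIndex_eq_of_succ {L : ℝ} {j : ℕ} {x y : Fin n → ℝ}
    (h : dyadicIndex L (j + 1) x = dyadicIndex L (j + 1) y) :
    dyadicIndex L j x = dyadicIndex L j y := by
  have key : ∀ t : ℝ, ⌊t⌋ = ⌊2 * t⌋ / 2 := by
    intro t
    rw [Int.floor_eq_iff]
    have h1 := Int.floor_le (2 * t)
    have h2 := Int.lt_floor_add_one (2 * t)
    generalize ⌊2 * t⌋ = m at *
    have h3 : m = 2 * (m / 2) + m % 2 := by omega
    have h4 : 0 ≤ m % 2 := by omega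
    have h5 : m % 2 ≤ 1 := by omega
    generalize m / 2 = q at *
    generalize m % 2 = s at *
    subst h3
    push_cast at h1 h2
    have h4' : (0 : ℝ) ≤ s := by exact_mod_cast h4
    have h5' : (s : ℝ) ≤ 1 := by exact_mod_cast h5
    constructor <;> linarith
  funext i
  have hi := congrFun h i
  simp only [dyadicIndex, pow_succ', mul_assoc] at hi ⊢
  rw [key, hi, ← key]

theorem dyadicIndex_eq_of_le {L : ℝ} {i j : ℕ} (hij : i ≤ j) {x y : Fin n → ℝ}
    (h : dyadicIndex L j x = dyadicIndex L j y) : dyadicIndex L i x = dyadicIndex L i y := by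
  induction j, hij using Nat.le_induction with
  | base => exact h
  | succ j _ ih => exact ih (dyadicIndex_eq_of_succ h)

theorem dyadicCell_eq_pi {L : ℝ} (hL : 0 < L) (j : ℕ) (v : Fin n → ℤ) :
    dyadicCell L j v =
      pi univ fun i => Ico (v i * (L / 2 ^ j)) ((v i + 1) * (L / 2 ^ j)) := by
  ext x
  simp only [dyadicCell, dyadicIndex, mem_preimage, mem_singleton_iff, funext_iff,
    Int.floor_eq_iff, Set.mem_pi, mem_univ, true_imp_iff, mem_Ico]
  refine forall_congr' fun i => ?_
  have e : (2 : ℝ) ^ j * (x i / L) = x i / (L / 2 ^ j) := by field_simp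
  rw [e, le_div_iff₀ (by positivity), div_lt_iff₀ (by positivity)]

theorem volume_dyadicCell {L : ℝ} (hL : 0 < L) (j : ℕ) (v : Fin n → ℤ) :
    volume (dyadicCell L j v) = ENNReal.ofReal ((L / 2 ^ j) ^ n) := by
  rw [dyadicCell_eq_pi hL, Real.volume_pi_Ico]
  have : ∀ i, ((v i + 1 : ℝ) * (L / 2 ^ j) - v i * (L / 2 ^ j)) = L / 2 ^ j := fun i => by ring
  simp only [this, Finset.prod_const, Finset.card_univ, Fintype.card_fin]
  rw [ENNReal.ofReal_pow (by positivity)]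

theorem volume_real_dyadicCell {L : ℝ} (hL : 0 < L) (j : ℕ) (v : Fin n → ℤ) :
    volume.real (dyadicCell L j v) = (L / 2 ^ j) ^ n := by
  rw [measureReal_def, volume_dyadicCell hL, ENNReal.toReal_ofReal (by positivity)]

theorem volume_dyadicCell_ne_top {L : ℝ} (hL : 0 < L) (j : ℕ) (v : Fin n → ℤ) :
    volume (dyadicCell L j v) ≠ ∞ := by
  rw [volume_dyadicCell hL]; exact ENNReal.ofReal_ne_top

/-- The centre of the cube `dyadicCell L j v`. -/
noncomputable def cellCenter (L : ℝ) (j : ℕ) (v : Fin n → ℤ) : Fin n → ℝ :=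
  fun i => (v i + 1 / 2) * (L / 2 ^ j)

theorem dyadicCell_subset_cube {L : ℝ} (hL : 0 < L) (j : ℕ) (v : Fin n → ℤ) :
    dyadicCell L j v ⊆ cube (cellCenter L j v) (L / 2 ^ j) := by
  rw [dyadicCell_eq_pi hL]
  intro x hx i
  obtain ⟨h1, h2⟩ := hx i (mem_univ i)
  rw [cellCenter, abs_le]
  constructor <;> linarith

theorem volume_cube_cellCenter {L : ℝ} (hL : 0 < L) (j : ℕ) (v : Fin n → ℤ) :
    volume (cube (cellCenter L j v) (L / 2 ^ j)) = volume (dyadicCell L j v) := by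
  rw [volume_dyadicCell hL, volume_cube _ (by positivity)]

/-- The average of `f` over the dyadic cube of generation `j` that contains `x`. -/
noncomputable def cellAvg (L : ℝ) (f : (Fin n → ℝ) → ℝ) (j : ℕ) (x : Fin n → ℝ) : ℝ :=
  ⨍ y in dyadicCell L j (dyadicIndex L j x), f y

theorem measurable_cellAvg (L : ℝ) (f : (Fin n → ℝ) → ℝ) (j : ℕ) :
    Measurable (cellAvg L f j) := by
  have : Measurable fun v : Fin n → ℤ => ⨍ y in dyadicCell L j v, f y :=
    measurable_of_countable _
  exact this.comp (measurable_dyadicIndex L j)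

theorem cellAvg_congr {L : ℝ} {f : (Fin n → ℝ) → ℝ} {j : ℕ} {x y : Fin n → ℝ}
    (h : dyadicIndex L j x = dyadicIndex L j y) : cellAvg L f j x = cellAvg L f j y := by
  rw [cellAvg, h, cellAvg]

theorem cellAvg_mul_pow {L : ℝ} (hL : 0 < L) (f : (Fin n → ℝ) → ℝ) (j : ℕ) (x : Fin n → ℝ) :
    cellAvg L f j x * (L / 2 ^ j) ^ n = ∫ y in dyadicCell L j (dyadicIndex L j x), f y := by
  have h := measure_smul_setAverage (μ := volume) f
    (volume_dyadicCell_ne_top hL j (dyadicIndex L j x))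
  rw [volume_real_dyadicCell hL] at h
  rw [← h, smul_eq_mul, mul_comm]
  rfl

theorem integrableOn_of_bounded {f : (Fin n → ℝ) → ℝ} {M : ℝ} (hf : Measurable f)
    (hM : ∀ x, |f x| ≤ M) {s : Set (Fin n → ℝ)} (hs : volume s ≠ ∞) : IntegrableOn f s :=
  Measure.integrableOn_of_bounded (M := M) hs hf.aestronglyMeasurable
    (Eventually.of_forall fun x => by simpa using hM x)

theorem abs_cellAvg_le {L : ℝ} (hL : 0 < L) (f : (Fin n → ℝ) → ℝ) (j : ℕ) (x : Fin n → ℝ) :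
    |cellAvg L f j x| ≤ cellAvg L (fun y => |f y|) j x := by
  have hpos : 0 < (L / 2 ^ j) ^ n := by positivity
  refine le_of_mul_le_mul_right ?_ hpos
  have e : |cellAvg L f j x| * (L / 2 ^ j) ^ n = |cellAvg L f j x * (L / 2 ^ j) ^ n| := by
    rw [abs_mul, abs_of_pos hpos]
  rw [e, cellAvg_mul_pow hL, cellAvg_mul_pow hL]
  exact abs_integral_le_integral_abs

theorem cellAvg_le {L : ℝ} (hL : 0 < L) {f : (Fin n → ℝ) → ℝ} {M : ℝ} (hf : Measurable f)
    (hM : ∀ x, |f x| ≤ M) (j : ℕ) (x : Fin n → ℝ) : cellAvg L (fun y => |f y|) j x ≤ M := by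
  have hpos : 0 < (L / 2 ^ j) ^ n := by positivity
  refine le_of_mul_le_mul_right ?_ hpos
  rw [cellAvg_mul_pow hL, ← volume_real_dyadicCell hL j (dyadicIndex L j x), mul_comm]
  have hi : IntegrableOn (fun y => |f y|) (dyadicCell L j (dyadicIndex L j x)) :=
    (integrableOn_of_bounded hf hM (volume_dyadicCell_ne_top hL j _)).abs
  calc ∫ y in dyadicCell L j (dyadicIndex L j x), |f y|
      ≤ ∫ y in dyadicCell L j (dyadicIndex L j x), M :=
        integral_mono hi (integrableOn_const (volume_dyadicCell_ne_top hL j _)) hM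
    _ = _ := by rw [setIntegral_const, smul_eq_mul]

/-- The parent cell has `2 ^ n` times the volume, and the integral of `|f|` over it is at least as
large. -/
theorem cellAvg_succ_le {L : ℝ} (hL : 0 < L) {f : (Fin n → ℝ) → ℝ} {M : ℝ} (hf : Measurable f)
    (hM : ∀ x, |f x| ≤ M) (j : ℕ) (x : Fin n → ℝ) :
    cellAvg L (fun y => |f y|) (j + 1) x ≤ 2 ^ n * cellAvg L (fun y => |f y|) j x := by
  have hpos : 0 < (L / 2 ^ (j + 1)) ^ n := by positivity
  refine le_of_mul_le_mul_right ?_ hpos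
  have e : (2 : ℝ) ^ n * cellAvg L (fun y => |f y|) j x * (L / 2 ^ (j + 1)) ^ n
      = cellAvg L (fun y => |f y|) j x * (L / 2 ^ j) ^ n := by
    rw [mul_comm ((2 : ℝ) ^ n), mul_assoc, ← mul_pow]
    congr 2
    rw [pow_succ]
    field_simp
  rw [e, cellAvg_mul_pow hL, cellAvg_mul_pow hL]
  refine setIntegral_mono_set
    (integrableOn_of_bounded hf hM (volume_dyadicCell_ne_top hL j _)).abs
    (Eventually.of_forall fun _ => abs_nonneg _) (LE.le.eventuallyLE ?_)
  intro y hy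
  exact dyadicIndex_eq_of_succ hy

/-- Lebesgue differentiation along dyadic cubes. -/
theorem ae_tendsto_cellAvg {L : ℝ} (hL : 0 < L) {f : (Fin n → ℝ) → ℝ}
    (hf : LocallyIntegrable f) :
    ∀ᵐ x, Tendsto (fun j => cellAvg L f j x) atTop (𝓝 (f x)) := by
  filter_upwards [IsUnifLocDoublingMeasure.ae_tendsto_average (μ := volume) hf 1] with x hx
  have hδ : Tendsto (fun j : ℕ => L / 2 ^ j / 2) atTop (𝓝[>] 0) := by
    refine tendsto_nhdsWithin_iff.2 ⟨?_, Eventually.of_forall fun j => ?_⟩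
    · have h := tendsto_pow_atTop_nhds_zero_of_lt_one (r := (1 / 2 : ℝ)) (by norm_num)
        (by norm_num)
      have h2 := h.const_mul (L / 2)
      rw [mul_zero] at h2
      refine h2.congr fun j => ?_
      rw [div_pow, one_pow]
      ring
    · rw [mem_Ioi]; positivity
  have key := hx (fun j => cellCenter L j (dyadicIndex L j x)) (fun j => L / 2 ^ j / 2) hδ
    (Eventually.of_forall fun j => by
      rw [one_mul, ← cube_eq_closedBall _ (by positivity)]
      exact dyadicCell_subset_cube hL j _ (self_mem_dyadicCell L j x))
  refine key.congr fun j => ?_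
  rw [← cube_eq_closedBall _ (by positivity)]
  -- The differentiation theorem concerns closed sup-norm balls; the half-open cell lies in such a
  -- ball and has the same volume, so the two differ by a null set.
  refine (setAverage_congr ?_).symm
  refine ae_eq_of_subset_of_measure_ge (dyadicCell_subset_cube hL j _)
    (volume_cube_cellCenter hL j _).le (measurableSet_dyadicCell L j _).nullMeasurableSet ?_
  rw [volume_cube_cellCenter hL]
  exact volume_dyadicCell_ne_top hL j _

/-! ### Calderón–Zygmund decomposition: stopping cubes and good parts. -/

/-- The points at which the dyadic averages of `|f|` exceed `t` for the first time at
generation `j`. -/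
def stopSet (L : ℝ) (f : (Fin n → ℝ) → ℝ) (t : ℝ) (j : ℕ) : Set (Fin n → ℝ) :=
  {x | t < cellAvg L (fun y => |f y|) j x ∧ ∀ i < j, cellAvg L (fun y => |f y|) i x ≤ t}

/-- The dyadic cube with index `σ` if it is maximal among those over which the average of `|f|`
exceeds `t`, and the empty set otherwise. -/
def stopCell (L : ℝ) (f : (Fin n → ℝ) → ℝ) (t : ℝ) (σ : ℕ × (Fin n → ℤ)) : Set (Fin n → ℝ) :=
  dyadicCell L σ.1 σ.2 ∩ stopSet L f t σ.1

open scoped Classical in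
/-- The good part of the Calderón–Zygmund decomposition of `f` at height `t`. -/
noncomputable def goodPart (L : ℝ) (f : (Fin n → ℝ) → ℝ) (t : ℝ) (x : Fin n → ℝ) : ℝ :=
  if h : ∃ j, t < cellAvg L (fun y => |f y|) j x then cellAvg L f (Nat.find h) x else f x

theorem measurableSet_stopSet (L : ℝ) (f : (Fin n → ℝ) → ℝ) (t : ℝ) (j : ℕ) :
    MeasurableSet (stopSet L f t j) := by
  have : stopSet L f t j = {x | t < cellAvg L (fun y => |f y|) j x} ∩
      ⋂ i, ⋂ _ : i < j, {x | cellAvg L (fun y => |f y|) i x ≤ t} := by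
    ext x; simp [stopSet]
  rw [this]
  exact (measurableSet_lt measurable_const (measurable_cellAvg L _ j)).inter
    (MeasurableSet.iInter fun i => MeasurableSet.iInter fun _ =>
      measurableSet_le (measurable_cellAvg L _ i) measurable_const)

theorem measurableSet_stopCell (L : ℝ) (f : (Fin n → ℝ) → ℝ) (t : ℝ) (σ : ℕ × (Fin n → ℤ)) :
    MeasurableSet (stopCell L f t σ) :=
  (measurableSet_dyadicCell L _ _).inter (measurableSet_stopSet L f t _)

/-- Stopping at generation `j` depends only on averages of generations at most `j`, which are
constant on a generation-`j` cell. So a `stopCell` is a whole cell or empty. -/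
theorem mem_stopSet_congr {L : ℝ} {f : (Fin n → ℝ) → ℝ} {t : ℝ} {j : ℕ} {x y : Fin n → ℝ}
    (h : dyadicIndex L j x = dyadicIndex L j y) (hx : x ∈ stopSet L f t j) :
    y ∈ stopSet L f t j := by
  refine ⟨(cellAvg_congr h) ▸ hx.1, fun i hi => ?_⟩
  rw [← cellAvg_congr (dyadicIndex_eq_of_le hi.le h)]
  exact hx.2 i hi

theorem stopCell_eq_of_mem {L : ℝ} {f : (Fin n → ℝ) → ℝ} {t : ℝ} {σ : ℕ × (Fin n → ℤ)}
    {x : Fin n → ℝ} (hx : x ∈ stopCell L f t σ) : stopCell L f t σ = dyadicCell L σ.1 σ.2 := by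
  refine inter_eq_left.2 fun y hy => mem_stopSet_congr ?_ hx.2
  exact (show dyadicIndex L σ.1 x = σ.2 from hx.1).trans
    (show dyadicIndex L σ.1 y = σ.2 from hy).symm

theorem stopSet_unique {L : ℝ} {f : (Fin n → ℝ) → ℝ} {t : ℝ} {i j : ℕ} {x : Fin n → ℝ}
    (hi : x ∈ stopSet L f t i) (hj : x ∈ stopSet L f t j) : i = j := by
  rcases lt_trichotomy i j with h | h | h
  · exact absurd hi.1 (not_lt.2 (hj.2 i h))
  · exact h
  · exact absurd hj.1 (not_lt.2 (hi.2 j h))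

theorem pairwise_disjoint_stopCell (L : ℝ) (f : (Fin n → ℝ) → ℝ) (t : ℝ) :
    Pairwise (Function.onFun Disjoint (stopCell L f t)) := by
  intro σ τ hne
  refine disjoint_left.2 fun x hσ hτ => hne ?_
  have h := stopSet_unique hσ.2 hτ.2
  refine Prod.ext h ?_
  have h1 : dyadicIndex L σ.1 x = σ.2 := hσ.1
  have h2 : dyadicIndex L τ.1 x = τ.2 := hτ.1
  rw [← h1, ← h2, h]

theorem exists_mem_stopSet {L : ℝ} {f : (Fin n → ℝ) → ℝ} {t : ℝ} {x : Fin n → ℝ} {j : ℕ}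
    (h : t < cellAvg L (fun y => |f y|) j x) : ∃ i ≤ j, x ∈ stopSet L f t i := by
  classical
  have hex : ∃ j, t < cellAvg L (fun y => |f y|) j x := ⟨j, h⟩
  exact ⟨Nat.find hex, Nat.find_min' hex h, Nat.find_spec hex,
    fun i hi => not_lt.1 (Nat.find_min hex hi)⟩

theorem mem_iUnion_stopCell {L : ℝ} {f : (Fin n → ℝ) → ℝ} {t : ℝ} {x : Fin n → ℝ} :
    x ∈ ⋃ σ, stopCell L f t σ ↔ ∃ j, t < cellAvg L (fun y => |f y|) j x := by
  rw [mem_iUnion]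
  constructor
  · rintro ⟨σ, hσ⟩
    exact ⟨σ.1, hσ.2.1⟩
  · rintro ⟨j, hj⟩
    obtain ⟨i, -, hi⟩ := exists_mem_stopSet hj
    exact ⟨(i, dyadicIndex L i x), rfl, hi⟩

theorem goodPart_of_mem_stopSet {L : ℝ} {f : (Fin n → ℝ) → ℝ} {t : ℝ} {x : Fin n → ℝ} {j : ℕ}
    (hx : x ∈ stopSet L f t j) : goodPart L f t x = cellAvg L f j x := by
  classical
  have hex : ∃ j, t < cellAvg L (fun y => |f y|) j x := ⟨j, hx.1⟩
  have hj : Nat.find hex = j := (Nat.find_eq_iff hex).2 ⟨hx.1, fun i hi => not_lt.2 (hx.2 i hi)⟩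
  rw [goodPart, dif_pos hex, hj]

theorem goodPart_of_forall_le {L : ℝ} {f : (Fin n → ℝ) → ℝ} {t : ℝ} {x : Fin n → ℝ}
    (hx : ∀ j, cellAvg L (fun y => |f y|) j x ≤ t) : goodPart L f t x = f x := by
  rw [goodPart, dif_neg]
  rintro ⟨j, hj⟩
  exact absurd hj (not_lt.2 (hx j))

theorem measurable_goodPart {L : ℝ} {f : (Fin n → ℝ) → ℝ} (hf : Measurable f) (t : ℝ) :
    Measurable (goodPart L f t) := by
  classical
  -- Index `0` stands for the points that never stop, index `j + 1` for those that stop at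
  -- generation `j`.
  let F : ℕ → (Fin n → ℝ) → ℝ := fun k => match k with
    | 0 => f
    | j + 1 => cellAvg L f j
  let p : ℕ → (Fin n → ℝ) → Prop := fun k x => match k with
    | 0 => x ∉ ⋃ σ, stopCell L f t σ
    | j + 1 => x ∈ stopSet L f t j
  have hF : ∀ k, Measurable (F k) := by
    rintro (_ | k)
    · exact hf
    · exact measurable_cellAvg L f k
  have hp : ∀ k, MeasurableSet {x | p k x} := by
    rintro (_ | k)
    · exact (MeasurableSet.iUnion (measurableSet_stopCell L f t)).compl
    · exact measurableSet_stopSet L f t k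
  have hex : ∀ x, ∃ k, p k x := by
    intro x
    by_cases hx : x ∈ ⋃ σ, stopCell L f t σ
    · obtain ⟨j, hj⟩ := mem_iUnion_stopCell.1 hx
      obtain ⟨i, -, hi⟩ := exists_mem_stopSet hj
      exact ⟨i + 1, hi⟩
    · exact ⟨0, hx⟩
  have hfind : Measurable fun x => F (Nat.find (hex x)) x :=
    Measurable.find hF hp hex
  refine (funext fun x => ?_ : goodPart L f t = fun x => F (Nat.find (hex x)) x) ▸ hfind
  have hs := Nat.find_spec (hex x)
  generalize Nat.find (hex x) = k at hs
  rcases k with _ | k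
  · refine goodPart_of_forall_le fun j => ?_
    by_contra! hj
    exact hs (mem_iUnion_stopCell.2 ⟨j, hj⟩)
  · exact goodPart_of_mem_stopSet hs

theorem abs_goodPart_le {L : ℝ} (hL : 0 < L) {f : (Fin n → ℝ) → ℝ} {M : ℝ} (hf : Measurable f)
    (hM : ∀ x, |f x| ≤ M) (t : ℝ) (x : Fin n → ℝ) : |goodPart L f t x| ≤ M := by
  by_cases h : ∃ j, t < cellAvg L (fun y => |f y|) j x
  · obtain ⟨j, hj⟩ := h
    obtain ⟨i, -, hi⟩ := exists_mem_stopSet hj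
    rw [goodPart_of_mem_stopSet hi]
    exact (abs_cellAvg_le hL f i x).trans (cellAvg_le hL hf hM i x)
  · push Not at h
    rw [goodPart_of_forall_le h]
    exact hM x

/-- On a stopping cube the parent's average was still at most `t`; `h0` guarantees that a parent
exists. Off the stopping cubes, Lebesgue differentiation gives `|f| ≤ t`. -/
theorem ae_abs_goodPart_le {L : ℝ} (hL : 0 < L) {f : (Fin n → ℝ) → ℝ} {M : ℝ}
    (hf : Measurable f) (hM : ∀ x, |f x| ≤ M) {t : ℝ} (ht : 0 ≤ t)
    (h0 : ∀ x, cellAvg L (fun y => |f y|) 0 x ≤ t) :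
    ∀ᵐ x, |goodPart L f t x| ≤ 2 ^ n * t := by
  have hloc : LocallyIntegrable (fun y => |f y|) (volume : Measure (Fin n → ℝ)) := by
    refine (locallyIntegrable_const M).mono hf.abs.aestronglyMeasurable
      (Eventually.of_forall fun x => ?_)
    simpa using (hM x).trans (le_abs_self M)
  filter_upwards [ae_tendsto_cellAvg hL hloc] with x hx
  by_cases h : ∃ j, t < cellAvg L (fun y => |f y|) j x
  · obtain ⟨j, hj⟩ := h
    obtain ⟨i, -, hi⟩ := exists_mem_stopSet hj
    rw [goodPart_of_mem_stopSet hi]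
    refine (abs_cellAvg_le hL f i x).trans ?_
    rcases i with _ | i
    · exact absurd hi.1 (not_lt.2 (h0 x))
    · exact (cellAvg_succ_le hL hf hM i x).trans
        (mul_le_mul_of_nonneg_left (hi.2 i i.lt_succ_self) (by positivity))
  · push Not at h
    rw [goodPart_of_forall_le h]
    refine (le_of_tendsto' hx h).trans ?_
    exact le_mul_of_one_le_left ht (one_le_pow₀ one_le_two)

theorem setIntegral_stopCell_goodPart {L : ℝ} (hL : 0 < L) (f : (Fin n → ℝ) → ℝ) (t : ℝ)
    (σ : ℕ × (Fin n → ℤ)) :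
    ∫ x in stopCell L f t σ, goodPart L f t x = ∫ x in stopCell L f t σ, f x := by
  rcases (stopCell L f t σ).eq_empty_or_nonempty with h | ⟨x, hx⟩
  · simp [h]
  have hxσ : dyadicIndex L σ.1 x = σ.2 := hx.1
  have hc : ∀ y ∈ stopCell L f t σ, goodPart L f t y = cellAvg L f σ.1 x := by
    intro y hy
    rw [goodPart_of_mem_stopSet hy.2]
    exact cellAvg_congr ((show dyadicIndex L σ.1 y = σ.2 from hy.1).trans hxσ.symm)
  rw [setIntegral_congr_fun (measurableSet_stopCell L f t σ) hc, stopCell_eq_of_mem hx,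
    setIntegral_const, volume_real_dyadicCell hL, smul_eq_mul, mul_comm, cellAvg_mul_pow hL, hxσ]

/-- The good part has the integral of `f` on each stopping cube and equals `f` elsewhere, and `U`
cuts no stopping cube. The case needed is that of `U` a stopping cube of a lower height. -/
theorem setIntegral_goodPart {L : ℝ} (hL : 0 < L) {f : (Fin n → ℝ) → ℝ} {M : ℝ}
    (hf : Measurable f) (hM : ∀ x, |f x| ≤ M) (t : ℝ) {U : Set (Fin n → ℝ)}
    (hU : MeasurableSet U) (hUfin : volume U ≠ ∞)
    (hcell : ∀ σ, (stopCell L f t σ ∩ U).Nonempty → stopCell L f t σ ⊆ U) :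
    ∫ x in U, goodPart L f t x = ∫ x in U, f x := by
  have hg := integrableOn_of_bounded (measurable_goodPart (L := L) hf t)
    (abs_goodPart_le hL hf hM t) hUfin
  have hfi := integrableOn_of_bounded hf hM hUfin
  have hΩ : MeasurableSet (⋃ σ, stopCell L f t σ) :=
    MeasurableSet.iUnion (measurableSet_stopCell L f t)
  rw [← integral_inter_add_sdiff hΩ hg, ← integral_inter_add_sdiff hΩ hfi]
  congr 1
  · rw [inter_iUnion]
    have hm : ∀ σ, MeasurableSet (U ∩ stopCell L f t σ) := fun σ =>
      hU.inter (measurableSet_stopCell L f t σ)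
    have hd : Pairwise (Function.onFun Disjoint fun σ => U ∩ stopCell L f t σ) := fun σ τ h =>
      (pairwise_disjoint_stopCell L f t h).mono inter_subset_right inter_subset_right
    have hsub : ⋃ σ, U ∩ stopCell L f t σ ⊆ U := iUnion_subset fun σ => inter_subset_left
    rw [integral_iUnion hm hd (hg.mono_set hsub), integral_iUnion hm hd (hfi.mono_set hsub)]
    refine tsum_congr fun σ => ?_
    rcases (stopCell L f t σ ∩ U).eq_empty_or_nonempty with h | h
    · rw [inter_comm, h]; simp
    · rw [inter_eq_right.2 (hcell σ h)]
      exact setIntegral_stopCell_goodPart hL f t σ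
  · refine setIntegral_congr_fun (hU.diff hΩ) fun x hx => goodPart_of_forall_le fun j => ?_
    by_contra! hj
    exact hx.2 (mem_iUnion_stopCell.2 ⟨j, hj⟩)

/-- Averages exceed the lower height `s` no later than `t`, so the cube at height `s` is the coarser
of two nested cells. -/
theorem stopCell_subset_of_le {L : ℝ} {f : (Fin n → ℝ) → ℝ} {s t : ℝ} (hst : s ≤ t)
    {σ τ : ℕ × (Fin n → ℤ)} (h : (stopCell L f t σ ∩ stopCell L f s τ).Nonempty) :
    stopCell L f t σ ⊆ stopCell L f s τ := by
  obtain ⟨x, hxσ, hxτ⟩ := h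
  have hle : τ.1 ≤ σ.1 := by
    by_contra! hlt
    exact absurd (hst.trans_lt hxσ.2.1) (not_lt.2 (hxτ.2.2 _ hlt))
  intro y hy
  rw [stopCell_eq_of_mem hxτ]
  have h1 : dyadicIndex L σ.1 y = dyadicIndex L σ.1 x :=
    (show dyadicIndex L σ.1 y = σ.2 from hy.1).trans
      (show dyadicIndex L σ.1 x = σ.2 from hxσ.1).symm
  exact (dyadicIndex_eq_of_le hle h1).trans hxτ.1

theorem volume_stopCell_ne_top {L : ℝ} (hL : 0 < L) (f : (Fin n → ℝ) → ℝ) (t : ℝ)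
    (σ : ℕ × (Fin n → ℤ)) : volume (stopCell L f t σ) ≠ ∞ :=
  measure_ne_top_of_subset inter_subset_left (volume_dyadicCell_ne_top hL _ _)

theorem setIntegral_stopCell_goodPart_of_le {L : ℝ} (hL : 0 < L) {f : (Fin n → ℝ) → ℝ} {M : ℝ}
    (hf : Measurable f) (hM : ∀ x, |f x| ≤ M) {s t : ℝ} (hst : s ≤ t) (τ : ℕ × (Fin n → ℤ)) :
    ∫ x in stopCell L f s τ, goodPart L f t x = ∫ x in stopCell L f s τ, f x :=
  setIntegral_goodPart hL hf hM t (measurableSet_stopCell L f s τ)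
    (volume_stopCell_ne_top hL f s τ) fun _ h => stopCell_subset_of_le hst h

theorem mul_volume_stopCell_le {L : ℝ} (hL : 0 < L) (f : (Fin n → ℝ) → ℝ) (t : ℝ)
    (σ : ℕ × (Fin n → ℤ)) :
    t * volume.real (stopCell L f t σ) ≤ ∫ x in stopCell L f t σ, |f x| := by
  rcases (stopCell L f t σ).eq_empty_or_nonempty with h | ⟨x, hx⟩
  · simp [h]
  have hxσ : dyadicIndex L σ.1 x = σ.2 := hx.1
  rw [stopCell_eq_of_mem hx, volume_real_dyadicCell hL, ← hxσ, ← cellAvg_mul_pow hL]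
  exact mul_le_mul_of_nonneg_right hx.2.1.le (by positivity)

/-- The weak type estimate for the dyadic maximal function. -/
theorem mul_volume_iUnion_stopCell_le {L : ℝ} (hL : 0 < L) {f : (Fin n → ℝ) → ℝ} (t : ℝ)
    (hf : Integrable f) (hfin : volume (⋃ σ, stopCell L f t σ) ≠ ∞) :
    t * volume.real (⋃ σ, stopCell L f t σ) ≤ ∫ x in ⋃ σ, stopCell L f t σ, |f x| := by
  have h1 := hasSum_integral_iUnion (μ := volume) (measurableSet_stopCell L f t)
    (pairwise_disjoint_stopCell L f t) (f := fun x => |f x|) hf.abs.integrableOn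
  have h2 := hasSum_integral_iUnion (μ := volume) (measurableSet_stopCell L f t)
    (pairwise_disjoint_stopCell L f t) (f := fun _ => t) (integrableOn_const hfin)
  simp only [setIntegral_const, smul_eq_mul] at h2
  rw [mul_comm]
  refine hasSum_le (fun σ => ?_) h2 h1
  rw [mul_comm]
  exact mul_volume_stopCell_le hL f t σ


theorem goodPart_eq_of_notMem {L : ℝ} {f : (Fin n → ℝ) → ℝ} {t : ℝ} {x : Fin n → ℝ}
    (hx : x ∉ ⋃ σ, stopCell L f t σ) : goodPart L f t x = f x := by
  refine goodPart_of_forall_le fun j => ?_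
  by_contra! hj
  exact hx (mem_iUnion_stopCell.2 ⟨j, hj⟩)

theorem goodPart_eq_goodPart_of_notMem {L : ℝ} {f : (Fin n → ℝ) → ℝ} {s t : ℝ} (hst : s ≤ t)
    {x : Fin n → ℝ} (hx : x ∉ ⋃ σ, stopCell L f s σ) :
    goodPart L f t x = goodPart L f s x := by
  rw [goodPart_eq_of_notMem hx]
  refine goodPart_of_forall_le fun j => ?_
  by_contra! hj
  exact hx (mem_iUnion_stopCell.2 ⟨j, hst.trans_lt hj⟩)

theorem goodPart_eq_self {L : ℝ} (hL : 0 < L) {f : (Fin n → ℝ) → ℝ} {M : ℝ} (hf : Measurable f)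
    (hM : ∀ x, |f x| ≤ M) {t : ℝ} (ht : M ≤ t) : goodPart L f t = f :=
  funext fun x => goodPart_of_forall_le fun j => (cellAvg_le hL hf hM j x).trans ht

/-- This cancellation makes the difference of two good parts a sum of atoms on the stopping cubes of
the lower height. -/
theorem setIntegral_stopCell_goodPart_sub {L : ℝ} (hL : 0 < L) {f : (Fin n → ℝ) → ℝ} {M : ℝ}
    (hf : Measurable f) (hM : ∀ x, |f x| ≤ M) {s t : ℝ} (hst : s ≤ t) (τ : ℕ × (Fin n → ℤ)) :
    ∫ x in stopCell L f s τ, (goodPart L f t x - goodPart L f s x) = 0 := by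
  have hi : ∀ t, IntegrableOn (goodPart L f t) (stopCell L f s τ) := fun t =>
    integrableOn_of_bounded (measurable_goodPart hf t) (abs_goodPart_le hL hf hM t)
      (volume_stopCell_ne_top hL f s τ)
  rw [integral_sub (hi t) (hi s), setIntegral_stopCell_goodPart_of_le hL hf hM hst,
    setIntegral_stopCell_goodPart hL, sub_self]

/-! ### Localization to a box and the sum over dyadic heights. -/

/-- The half-open cube of side length `2 * L` centred at the origin, as a union of dyadic
cubes. -/
noncomputable def dyadicBox (n : ℕ) (L : ℝ) : Set (Fin n → ℝ) :=
  dyadicIndex L 0 ⁻¹' {v | ∀ i, v i = -1 ∨ v i = 0}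

theorem mem_dyadicBox {L : ℝ} (hL : 0 < L) {x : Fin n → ℝ} :
    x ∈ dyadicBox n L ↔ ∀ i, -L ≤ x i ∧ x i < L := by
  simp only [dyadicBox, mem_preimage, mem_ofPred_eq, dyadicIndex, Int.floor_eq_iff]
  refine forall_congr' fun i => ?_
  have e : x i = L * (x i / L) := by field_simp
  generalize x i / L = y at *
  rw [e, pow_zero, one_mul]
  push_cast
  constructor
  · rintro (⟨h1, h2⟩ | ⟨h1, h2⟩) <;> constructor <;> nlinarith
  · rintro ⟨h1, h2⟩
    rcases lt_or_ge y 0 with h | h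
    · left; constructor <;> nlinarith
    · right; constructor <;> nlinarith

theorem dyadicBox_subset_cube {L : ℝ} (hL : 0 < L) : dyadicBox n L ⊆ cube 0 (2 * L) := by
  intro x hx i
  obtain ⟨h1, h2⟩ := (mem_dyadicBox hL).1 hx i
  rw [Pi.zero_apply, sub_zero, abs_le]
  constructor <;> linarith

theorem volume_dyadicBox_ne_top {L : ℝ} (hL : 0 < L) : volume (dyadicBox n L) ≠ ∞ :=
  measure_ne_top_of_subset (dyadicBox_subset_cube hL)
    (isCompact_cube 0 (by positivity)).measure_lt_top.ne

/-- The box is a union of generation-0 cells, so a cell through a point outside misses it entirely.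
-/
theorem cellAvg_eq_zero {L : ℝ} {f : (Fin n → ℝ) → ℝ} (hf : ∀ x ∉ dyadicBox n L, f x = 0)
    {x : Fin n → ℝ} (hx : x ∉ dyadicBox n L) (j : ℕ) : cellAvg L (fun y => |f y|) j x = 0 := by
  have : ∀ y ∈ dyadicCell L j (dyadicIndex L j x), |f y| = 0 := by
    intro y hy
    rw [hf y, abs_zero]
    intro hyb
    refine hx ?_
    have h := dyadicIndex_eq_of_le (Nat.zero_le j) (show dyadicIndex L j y = dyadicIndex L j x from hy)
    rw [dyadicBox, mem_preimage] at hyb ⊢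
    rwa [← h]
  rw [cellAvg, setAverage_eq, setIntegral_congr_fun (measurableSet_dyadicCell L j _) this]
  simp

theorem iUnion_stopCell_subset {L : ℝ} {f : (Fin n → ℝ) → ℝ}
    (hf : ∀ x ∉ dyadicBox n L, f x = 0) {t : ℝ} (ht : 0 ≤ t) :
    ⋃ σ, stopCell L f t σ ⊆ dyadicBox n L := by
  intro x hx
  by_contra hxb
  obtain ⟨j, hj⟩ := mem_iUnion_stopCell.1 hx
  rw [cellAvg_eq_zero hf hxb] at hj
  exact absurd hj (not_lt.2 ht)

theorem goodPart_eq_zero {L : ℝ} {f : (Fin n → ℝ) → ℝ} (hf : ∀ x ∉ dyadicBox n L, f x = 0)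
    {t : ℝ} (ht : 0 ≤ t) {x : Fin n → ℝ} (hx : x ∉ dyadicBox n L) : goodPart L f t x = 0 := by
  rw [goodPart_eq_of_notMem fun h => hx (iUnion_stopCell_subset hf ht h), hf x hx]

theorem integrable_of_bounded {L : ℝ} (hL : 0 < L) {f : (Fin n → ℝ) → ℝ} {M : ℝ}
    (hf : Measurable f) (hM : ∀ x, |f x| ≤ M) (hbox : ∀ x ∉ dyadicBox n L, f x = 0) :
    Integrable f :=
  (integrableOn_iff_integrable_of_support_subset
    (Function.support_subset_iff'.2 hbox)).1
      (integrableOn_of_bounded hf hM (volume_dyadicBox_ne_top hL))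

theorem integrable_sq_of_bounded {L : ℝ} (hL : 0 < L) {f : (Fin n → ℝ) → ℝ} {M : ℝ}
    (hf : Measurable f) (hM : ∀ x, |f x| ≤ M) (hbox : ∀ x ∉ dyadicBox n L, f x = 0) :
    Integrable fun x => f x ^ 2 := by
  refine integrable_of_bounded hL (M := M ^ 2) (hf.pow_const 2) (fun x => ?_) fun x hx => ?_
  · rw [abs_pow]
    exact pow_le_pow_left₀ (abs_nonneg _) (hM x) 2
  · rw [hbox x hx, zero_pow two_ne_zero]

/-- Integrate `|f| ≤ (1 + f²) / 2` over a generation-0 cell, whose volume is `L ^ n`. Hence no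
stopping occurs at generation 0 for heights at least 1. -/
theorem cellAvg_zero_le_one {L : ℝ} (hL : 0 < L) {f : (Fin n → ℝ) → ℝ} {M : ℝ}
    (hf : Measurable f) (hM : ∀ x, |f x| ≤ M) (hbox : ∀ x ∉ dyadicBox n L, f x = 0)
    (hf2 : ∫ x, f x ^ 2 ≤ L ^ n) (x : Fin n → ℝ) : cellAvg L (fun y => |f y|) 0 x ≤ 1 := by
  have hpos : 0 < (L / 2 ^ 0) ^ n := by positivity
  refine le_of_mul_le_mul_right ?_ hpos
  rw [cellAvg_mul_pow hL]
  set D := dyadicCell L 0 (dyadicIndex L 0 x)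
  have hD : volume D ≠ ∞ := volume_dyadicCell_ne_top hL 0 _
  have hsq := integrable_sq_of_bounded hL hf hM hbox
  have hc : Integrable (fun _ => (1 / 2 : ℝ)) (volume.restrict D) := integrableOn_const hD
  calc ∫ y in D, |f y| ≤ ∫ y in D, (1 / 2 + f y ^ 2 * (1 / 2)) := by
        refine integral_mono (integrableOn_of_bounded hf hM hD).abs
          ((integrableOn_const hD).add (hsq.integrableOn.mul_const _)) fun y => ?_
        have h := sq_nonneg (|f y| - 1)
        have h2 := sq_abs (f y)
        simp only
        nlinarith
    _ = volume.real D * (1 / 2) + (∫ y in D, f y ^ 2) * (1 / 2) := by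
        rw [integral_add hc (hsq.integrableOn.mul_const _),
          setIntegral_const, integral_mul_const, smul_eq_mul]
    _ ≤ L ^ n * (1 / 2) + L ^ n * (1 / 2) := by
        have h1 : volume.real D = L ^ n := by
          rw [volume_real_dyadicCell hL, pow_zero, div_one]
        have h2 : ∫ y in D, f y ^ 2 ≤ ∫ y, f y ^ 2 :=
          setIntegral_le_integral hsq (Eventually.of_forall fun y => sq_nonneg _)
        rw [h1]
        linarith
    _ = 1 * (L / 2 ^ 0) ^ n := by rw [pow_zero, div_one]; ring

theorem sum_two_pow_ite_le (N : ℕ) {y : ℝ} (hy : 0 ≤ y) :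
    ∑ k ∈ Finset.range N, (if (2 : ℝ) ^ k < y then (2 : ℝ) ^ k else 0) ≤ 2 * y := by
  induction N with
  | zero => simpa using hy
  | succ N ih =>
    by_cases h : (2 : ℝ) ^ N < y
    · have h1 : ∑ k ∈ Finset.range (N + 1), (if (2 : ℝ) ^ k < y then (2 : ℝ) ^ k else 0)
          ≤ ∑ k ∈ Finset.range (N + 1), (2 : ℝ) ^ k := by
        refine Finset.sum_le_sum fun k _ => ?_
        split_ifs
        · exact le_rfl
        · positivity
      rw [geom_sum_eq (by norm_num)] at h1
      rw [pow_succ] at h1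
      linarith
    · rw [Finset.sum_range_succ, if_neg h, add_zero]
      exact ih

/-- In the weak type inequality only the part of `f` with `|f| > 2 ^ k / 2` matters. Summing over
`k` under the integral leaves a geometric series dominated by a multiple of `|f|`. -/
theorem sum_four_pow_mul_volume_le {L : ℝ} (hL : 0 < L) {f : (Fin n → ℝ) → ℝ} {M : ℝ}
    (hf : Measurable f) (hM : ∀ x, |f x| ≤ M) (hbox : ∀ x ∉ dyadicBox n L, f x = 0) (N : ℕ) :
    ∑ k ∈ Finset.range N, 4 ^ k * volume.real (⋃ σ, stopCell L f (2 ^ k) σ)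
      ≤ 8 * ∫ x, f x ^ 2 := by
  have hsq := integrable_sq_of_bounded hL hf hM hbox
  have hfi := integrable_of_bounded hL hf hM hbox
  let φ : ℕ → (Fin n → ℝ) → ℝ := fun k x => if (2 : ℝ) ^ k < 2 * |f x| then (2 : ℝ) ^ k else 0
  have hφm : ∀ k, Measurable (φ k) := fun k =>
    Measurable.ite (measurableSet_lt measurable_const (hf.abs.const_mul 2)) measurable_const
      measurable_const
  have hφ0 : ∀ k x, 0 ≤ φ k x := fun k x => by simp only [φ]; split_ifs <;> positivity
  have hφb : ∀ k x, φ k x ≤ 2 ^ k := fun k x => by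
    simp only [φ]; split_ifs
    · exact le_rfl
    · positivity
  have hint : ∀ k, Integrable fun x => φ k x * |f x| := fun k =>
    hfi.abs.bdd_mul (c := 2 ^ k) (hφm k).aestronglyMeasurable (Eventually.of_forall fun x => by
      rw [Real.norm_eq_abs, abs_of_nonneg (hφ0 k x)]; exact hφb k x)
  have key : ∀ k, 4 ^ k * volume.real (⋃ σ, stopCell L f (2 ^ k) σ)
      ≤ 2 * ∫ x, φ k x * |f x| := by
    intro k
    have hfin : volume (⋃ σ, stopCell L f (2 ^ k) σ) ≠ ∞ :=
      measure_ne_top_of_subset (iUnion_stopCell_subset hbox (by positivity))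
        (volume_dyadicBox_ne_top hL)
    have hw := mul_volume_iUnion_stopCell_le hL (2 ^ k) hfi hfin
    set Ω := ⋃ σ, stopCell L f (2 ^ k) σ
    have h2k : (0 : ℝ) < 2 ^ k := by positivity
    have h4 : (4 : ℝ) ^ k = 2 ^ k * 2 ^ k := by rw [← mul_pow]; norm_num
    -- Where `|f| ≤ 2 ^ k / 2` the integrand is at most `4 ^ k / 2`; this contributes half of `4 ^ k
    -- |Ω|`, which is absorbed in the left side.
    have h1 : ∫ x in Ω, 2 ^ k * |f x| ≤ ∫ x in Ω, (4 ^ k * (1 / 2) + φ k x * |f x|) := by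
      refine integral_mono (hfi.abs.integrableOn.const_mul _)
        ((integrableOn_const hfin).add (hint k).integrableOn) fun x => ?_
      simp only [φ]
      split_ifs with h
      · have : (0 : ℝ) < 4 ^ k := by positivity
        linarith
      · rw [h4]; nlinarith
    have hc : Integrable (fun _ => (4 ^ k * (1 / 2) : ℝ)) (volume.restrict Ω) :=
      integrableOn_const hfin
    rw [integral_const_mul, integral_add hc (hint k).integrableOn,
      setIntegral_const, smul_eq_mul] at h1
    have h2 : ∫ x in Ω, φ k x * |f x| ≤ ∫ x, φ k x * |f x| :=
      setIntegral_le_integral (hint k)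
        (Eventually.of_forall fun x => mul_nonneg (hφ0 k x) (abs_nonneg _))
    have h3 := mul_le_mul_of_nonneg_left hw h2k.le
    rw [← mul_assoc, ← h4] at h3
    linarith
  calc _ ≤ ∑ k ∈ Finset.range N, 2 * ∫ x, φ k x * |f x| := Finset.sum_le_sum fun k _ => key k
    _ = 2 * ∫ x, ∑ k ∈ Finset.range N, φ k x * |f x| := by
        rw [← Finset.mul_sum, integral_finsetSum _ fun k _ => hint k]
    _ ≤ 2 * ∫ x, 4 * f x ^ 2 := by
        refine mul_le_mul_of_nonneg_left (integral_mono (integrable_finsetSum _ fun k _ => hint k)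
          (hsq.const_mul 4) fun x => ?_) zero_le_two
        simp only
        rw [← Finset.sum_mul]
        have h := sum_two_pow_ite_le N (y := 2 * |f x|) (by positivity)
        have h' := mul_le_mul_of_nonneg_right h (abs_nonneg (f x))
        have h2 := abs_mul_abs_self (f x)
        simp only [φ]
        nlinarith
    _ = 8 * ∫ x, f x ^ 2 := by rw [integral_const_mul]; ring

/-! ### The space `L^∞_c` and the bilinear form of `T`. -/

theorem IsLinftyc.of_bounded {f : (Fin n → ℝ) → ℝ} (hf : AEStronglyMeasurable f volume) {α : ℝ}
    (hα : ∀ᵐ x, |f x| ≤ α) {c : Fin n → ℝ} {l : ℝ} (hl : 0 ≤ l)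
    (hsupp : ∀ x ∉ cube c l, f x = 0) : IsLinftyc f :=
  ⟨memLp_top_of_bound hf α hα, HasCompactSupport.intro (isCompact_cube c hl) hsupp⟩

theorem IsLinftyc.add {f g : (Fin n → ℝ) → ℝ} (hf : IsLinftyc f) (hg : IsLinftyc g) :
    IsLinftyc (f + g) :=
  ⟨hf.memLp_top.add hg.memLp_top, hf.compact.add hg.compact⟩

theorem IsLinftyc.smul {f : (Fin n → ℝ) → ℝ} (hf : IsLinftyc f) (a : ℝ) : IsLinftyc (a • f) :=
  ⟨hf.memLp_top.const_smul a, hf.compact.smul_left (f := fun _ => a)⟩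

theorem IsLinftyc.sub {f g : (Fin n → ℝ) → ℝ} (hf : IsLinftyc f) (hg : IsLinftyc g) :
    IsLinftyc (f - g) := by
  have : f - g = f + (-1 : ℝ) • g := by ext x; simp [sub_eq_add_neg]
  rw [this]
  exact hf.add (hg.smul _)

theorem IsLinftyc.indicator {f : (Fin n → ℝ) → ℝ} (hf : IsLinftyc f) {s : Set (Fin n → ℝ)}
    (hs : MeasurableSet s) : IsLinftyc (s.indicator f) :=
  ⟨hf.memLp_top.indicator hs, hf.compact.mono (by rw [Set.support_indicator]; exact inter_subset_right)⟩

theorem IsLinftyc.aestronglyMeasurable {f : (Fin n → ℝ) → ℝ} (hf : IsLinftyc f) :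
    AEStronglyMeasurable f volume := hf.memLp_top.1

theorem IsLinftyc.exists_bound {f : (Fin n → ℝ) → ℝ} (hf : IsLinftyc f) :
    ∃ M : ℝ, 0 ≤ M ∧ ∀ᵐ x, |f x| ≤ M := by
  refine ⟨(eLpNormEssSup f volume).toReal, ENNReal.toReal_nonneg, ?_⟩
  have hfin : eLpNormEssSup f volume ≠ ∞ := by
    rw [← eLpNorm_exponent_top]; exact hf.memLp_top.2.ne
  filter_upwards [ae_le_eLpNormEssSup (f := f) (μ := volume)] with x hx
  rw [← Real.norm_eq_abs, ← toReal_enorm]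
  exact ENNReal.toReal_mono hfin hx

theorem IsLinftyc.integrable_mul {f G : (Fin n → ℝ) → ℝ} (hf : IsLinftyc f)
    (hG : LocallyIntegrable G volume) : Integrable fun x => f x * G x := by
  obtain ⟨M, -, hM⟩ := hf.exists_bound
  have h1 : IntegrableOn G (tsupport f) := hG.integrableOn_isCompact hf.compact.isCompact
  have h2 : IntegrableOn (fun x => f x * G x) (tsupport f) :=
    h1.bdd_mul (c := M) hf.aestronglyMeasurable.restrict (ae_restrict_of_ae hM)
  refine (integrableOn_iff_integrable_of_support_subset ?_).1 h2
  refine Function.support_subset_iff'.2 fun x hx => ?_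
  rw [image_eq_zero_of_notMem_tsupport hx, zero_mul]

theorem IsLinftyc.integrable_mul' {f G : (Fin n → ℝ) → ℝ} (hf : IsLinftyc f)
    (hG : LocallyIntegrable G volume) : Integrable fun x => G x * f x := by
  simpa only [mul_comm] using hf.integrable_mul hG

theorem IsLinftyc.integrable {f : (Fin n → ℝ) → ℝ} (hf : IsLinftyc f) : Integrable f := by
  simpa using hf.integrable_mul (locallyIntegrable_const (1 : ℝ))

/-- The bilinear form associated with the operator `T`. -/
noncomputable def pairing (T : ((Fin n → ℝ) → ℝ) → ((Fin n → ℝ) → ℝ)) (f g : (Fin n → ℝ) → ℝ) :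
    ℝ := ∫ x, T f x * g x

section Pairing

variable {T Tstar : ((Fin n → ℝ) → ℝ) → ((Fin n → ℝ) → ℝ)} {f g h : (Fin n → ℝ) → ℝ}

theorem pairing_congr_left (hT : IsLinearOperator T) (hf : IsLinftyc f) (hg : IsLinftyc g)
    (hfg : f =ᵐ[volume] g) : pairing T f h = pairing T g h := by
  refine integral_congr_ae ?_
  filter_upwards [hT.congr f g hf hg hfg] with x hx
  rw [hx]

theorem pairing_congr_right (hfg : f =ᵐ[volume] g) : pairing T h f = pairing T h g := by
  refine integral_congr_ae ?_
  filter_upwards [hfg] with x hx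
  rw [hx]

theorem pairing_add_left (hT : IsLinearOperator T) (hf : IsLinftyc f) (hg : IsLinftyc g)
    (hh : IsLinftyc h) : pairing T (f + g) h = pairing T f h + pairing T g h := by
  rw [pairing, pairing, pairing, ← integral_add (hh.integrable_mul' (hT.locallyIntegrable f hf))
    (hh.integrable_mul' (hT.locallyIntegrable g hg))]
  refine integral_congr_ae ?_
  filter_upwards [hT.add f g hf hg] with x hx
  rw [hx, Pi.add_apply, add_mul]

theorem pairing_add_right (hT : IsLinearOperator T) (hf : IsLinftyc f) (hg : IsLinftyc g)
    (hh : IsLinftyc h) : pairing T h (f + g) = pairing T h f + pairing T h g := by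
  rw [pairing, pairing, pairing, ← integral_add (hf.integrable_mul' (hT.locallyIntegrable h hh))
    (hg.integrable_mul' (hT.locallyIntegrable h hh))]
  simp only [Pi.add_apply, mul_add]

theorem pairing_sub_left (hT : IsLinearOperator T) (hf : IsLinftyc f) (hg : IsLinftyc g)
    (hh : IsLinftyc h) : pairing T (f - g) h = pairing T f h - pairing T g h := by
  have := pairing_add_left hT (hf.sub hg) hg hh
  rw [sub_add_cancel] at this
  rw [this, add_sub_cancel_right]

theorem pairing_sub_right (hT : IsLinearOperator T) (hf : IsLinftyc f) (hg : IsLinftyc g)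
    (hh : IsLinftyc h) : pairing T h (f - g) = pairing T h f - pairing T h g := by
  have := pairing_add_right hT (hf.sub hg) hg hh
  rw [sub_add_cancel] at this
  rw [this, add_sub_cancel_right]

theorem pairing_smul_left (hT : IsLinearOperator T) (hf : IsLinftyc f) (a : ℝ) :
    pairing T (a • f) h = a * pairing T f h := by
  rw [pairing, pairing, ← integral_const_mul]
  refine integral_congr_ae ?_
  filter_upwards [hT.smul a f hf] with x hx
  rw [hx, Pi.smul_apply, smul_eq_mul, mul_assoc]

theorem pairing_smul_right (a : ℝ) : pairing T f (a • h) = a * pairing T f h := by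
  rw [pairing, pairing, ← integral_const_mul]
  refine integral_congr_ae (Eventually.of_forall fun x => ?_)
  simp only [Pi.smul_apply, smul_eq_mul]
  ring

theorem pairing_eq_transpose (hTstar : IsTranspose T Tstar) (hf : IsLinftyc f)
    (hg : IsLinftyc g) : pairing T f g = ∫ x, f x * Tstar g x := hTstar.duality f g hf hg

end Pairing

/-! ### From testing on indicators to testing on bounded functions. -/

/-- `T` maps bounded functions on a cube boundedly to integrable functions on the same cube. -/
def LocallyTested (T : ((Fin n → ℝ) → ℝ) → ((Fin n → ℝ) → ℝ)) (D : ℝ) : Prop :=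
  ∀ (c : Fin n → ℝ) (l : ℝ), 0 < l → ∀ f g : (Fin n → ℝ) → ℝ, IsLinftyc f → IsLinftyc g →
    (∀ x ∉ cube c l, f x = 0) → (∀ x ∉ cube c l, g x = 0) → ∀ α β : ℝ, 0 ≤ α → 0 ≤ β →
    (∀ᵐ x, |f x| ≤ α) → (∀ᵐ x, |g x| ≤ β) → |pairing T f g| ≤ D * α * β * l ^ n

theorem locallyTested_of_indicator {T Tstar : ((Fin n → ℝ) → ℝ) → ((Fin n → ℝ) → ℝ)}
    (hT : IsLinearOperator T) (hTstar : IsTranspose T Tstar) {C : ℝ}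
    (hC : ∀ (c : Fin n → ℝ) (l : ℝ), 0 < l →
      ∀ E : Set (Fin n → ℝ), MeasurableSet E → E ⊆ cube c l →
        ∫ x in cube c l, |Tstar (E.indicator 1) x| ≤ C * (volume (cube c l)).toReal) :
    LocallyTested T (2 * C) := by
  intro c l hl f g hf hg hfQ hgQ α β hα hβ hfα hgβ
  have hQ := measurableSet_cube c hl.le
  have hset : ∀ E, MeasurableSet E → E ⊆ cube c l → |∫ x in E, T f x| ≤ α * C * l ^ n := by
    intro E hE hEQ
    have hEc : IsLinftyc (E.indicator (1 : (Fin n → ℝ) → ℝ)) := by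
      refine IsLinftyc.of_bounded (α := 1) (c := c) (l := l)
        (stronglyMeasurable_one.indicator hE).aestronglyMeasurable
        (Eventually.of_forall fun x => ?_) hl.le fun x hx =>
          indicator_of_notMem (fun h => hx (hEQ h)) _
      by_cases hx : x ∈ E <;> simp [hx]
    have h1 : ∫ x in E, T f x = pairing T f (E.indicator 1) := by
      rw [pairing, ← integral_indicator hE]
      refine integral_congr_ae (Eventually.of_forall fun x => ?_)
      by_cases hx : x ∈ E <;> simp [hx]
    have hloc := hTstar.locallyIntegrable _ hEc
    rw [h1, pairing_eq_transpose hTstar hf hEc,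
      ← setIntegral_eq_integral_of_forall_compl_eq_zero (s := cube c l)
        fun x hx => by rw [hfQ x hx, zero_mul]]
    have hi := (hloc.integrableOn_isCompact (isCompact_cube c hl.le)).abs
    calc |∫ x in cube c l, f x * Tstar (E.indicator 1) x|
        ≤ ∫ x in cube c l, |f x * Tstar (E.indicator 1) x| := abs_integral_le_integral_abs
      _ ≤ ∫ x in cube c l, α * |Tstar (E.indicator 1) x| := by
          refine integral_mono_ae (hf.integrable_mul hloc).abs.integrableOn (hi.const_mul α) ?_
          filter_upwards [ae_restrict_of_ae hfα] with x hx
          rw [abs_mul]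
          exact mul_le_mul_of_nonneg_right hx (abs_nonneg _)
      _ ≤ α * C * l ^ n := by
          rw [integral_const_mul, mul_assoc, ← toReal_volume_cube c hl.le]
          exact mul_le_mul_of_nonneg_left (hC c l hl E hE hEQ) hα
  have hTf := hT.locallyIntegrable f hf
  have hTfQ : IntegrableOn (T f) (cube c l) :=
    hTf.integrableOn_isCompact (isCompact_cube c hl.le)
  obtain ⟨F, hFm, hTF⟩ : ∃ F, Measurable F ∧ T f =ᵐ[volume] F :=
    ⟨_, hTf.aestronglyMeasurable.stronglyMeasurable_mk.measurable,
      hTf.aestronglyMeasurable.ae_eq_mk⟩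
  have hFQ : IntegrableOn F (cube c l) := hTfQ.congr (ae_restrict_of_ae hTF)
  have habs : ∫ x in cube c l, |T f x| ≤ 2 * C * α * l ^ n := by
    have h1 : ∫ x in cube c l, |T f x| = ∫ x in cube c l, ‖F x‖ := by
      refine integral_congr_ae (ae_restrict_of_ae ?_)
      filter_upwards [hTF] with x hx
      rw [hx, Real.norm_eq_abs]
    have hset' : ∀ E, MeasurableSet E →
        |∫ x in E, F x ∂(volume.restrict (cube c l))| ≤ α * C * l ^ n := by
      intro E hE
      rw [Measure.restrict_restrict hE,
        ← integral_congr_ae (ae_restrict_of_ae hTF)]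
      exact hset _ (hE.inter hQ) inter_subset_right
    -- The sets `{F ≥ 0}` and `{F ≤ 0}` are measurable, and each contributes at most `α * C * l ^
    -- n`; hence the factor `2`.
    rw [h1, integral_norm_eq_pos_sub_neg hFQ]
    have h2 := hset' {x | 0 ≤ F x} (measurableSet_le measurable_const hFm)
    have h3 := hset' {x | F x ≤ 0} (measurableSet_le hFm measurable_const)
    have h4 := abs_le.1 h2
    have h5 := abs_le.1 h3
    linarith [h4.2, h5.1]
  rw [pairing, ← setIntegral_eq_integral_of_forall_compl_eq_zero (s := cube c l)
    fun x hx => by rw [hgQ x hx, mul_zero]]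
  calc |∫ x in cube c l, T f x * g x| ≤ ∫ x in cube c l, |T f x * g x| :=
        abs_integral_le_integral_abs
    _ ≤ ∫ x in cube c l, |T f x| * β := by
        refine integral_mono_ae (hg.integrable_mul' hTf).abs.integrableOn
          (hTfQ.abs.mul_const β) ?_
        filter_upwards [ae_restrict_of_ae hgβ] with x hx
        rw [abs_mul]
        exact mul_le_mul_of_nonneg_left hx (abs_nonneg _)
    _ = (∫ x in cube c l, |T f x|) * β := integral_mul_const _ _
    _ ≤ (2 * C * α * l ^ n) * β := mul_le_mul_of_nonneg_right habs hβ
    _ = _ := by ring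

/-! ### Off-diagonal estimates from the Hörmander conditions. -/

theorem exists_mem_cube_sdiff {c x : Fin n → ℝ} {l : ℝ} (hl : 0 < l) (hx : x ∉ cube c l) :
    ∃ k : ℕ, x ∈ cube c (2 ^ (k + 1) * l) \ cube c (2 ^ k * l) := by
  classical
  have hex : ∃ k : ℕ, x ∈ cube c (2 ^ k * l) := by
    obtain ⟨k, hk⟩ := pow_unbounded_of_one_lt (dist x c * 2 / l) (one_lt_two (α := ℝ))
    refine ⟨k, ?_⟩
    rw [cube_eq_closedBall c (by positivity), Metric.mem_closedBall]
    rw [div_lt_iff₀ hl] at hk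
    linarith
  have h0 : Nat.find hex ≠ 0 := by
    intro h
    have hs := Nat.find_spec hex
    rw [h, pow_zero, one_mul] at hs
    exact hx hs
  obtain ⟨k, hk⟩ := Nat.exists_eq_succ_of_ne_zero h0
  refine ⟨k, ?_, Nat.find_min hex (by omega)⟩
  have hs := Nat.find_spec hex
  rwa [hk] at hs

/-- The classes `H_r`, `r ≥ 1`, are contained in `H_1`. -/
theorem HormanderClass.exists_setLIntegral_le {r : ℝ≥0∞}
    {K : (Fin n → ℝ) → (Fin n → ℝ) → ℝ} (hr : 1 ≤ r) (hK : HormanderClass r K)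
    (hm : ∀ x, AEStronglyMeasurable (fun y => K x y) volume) :
    ∃ A : ℝ≥0, ∀ (c : Fin n → ℝ) (l : ℝ), 0 < l →
      ∀ x ∈ cube c (2⁻¹ * l), ∀ x' ∈ cube c (2⁻¹ * l),
        ∫⁻ y in (cube c l)ᶜ, ‖K x y - K x' y‖ₑ ≤ A := by
  obtain ⟨A, hA⟩ := hK
  refine ⟨A, fun c l hl x hx x' hx' => le_trans ?_ (hA c l hl x hx x' hx')⟩
  calc ∫⁻ y in (cube c l)ᶜ, ‖K x y - K x' y‖ₑ
      ≤ ∫⁻ y in ⋃ k : ℕ, cube c (2 ^ (k + 1) * l) \ cube c (2 ^ k * l), ‖K x y - K x' y‖ₑ :=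
        lintegral_mono_set fun y hy => mem_iUnion.2 (exists_mem_cube_sdiff hl hy)
    _ ≤ ∑' k : ℕ, ∫⁻ y in cube c (2 ^ (k + 1) * l) \ cube c (2 ^ k * l), ‖K x y - K x' y‖ₑ :=
        lintegral_iUnion_le _ _
    _ ≤ _ := by
        refine ENNReal.tsum_le_tsum fun k => ?_
        rw [← eLpNorm_one_eq_lintegral_enorm, mul_comm (_ ^ _) (eLpNorm _ _ _)]
        -- Hölder on each annulus, whose volume is at most that of the enclosing cube.
        refine (eLpNorm_le_eLpNorm_mul_rpow_measure_univ hr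
          ((hm x).sub (hm x')).restrict).trans (mul_le_mul_right ?_ _)
        rw [Measure.restrict_apply_univ, ENNReal.toReal_one, one_div_one, one_div,
          ENNReal.toReal_inv]
        refine ENNReal.rpow_le_rpow (measure_mono sdiff_subset) ?_
        rw [← ENNReal.toReal_inv, sub_nonneg, ← ENNReal.toReal_one]
        exact ENNReal.toReal_mono ENNReal.one_ne_top (ENNReal.inv_le_one.2 hr)

/-- A function with mean zero on a cube is mapped by `T` to an integrable function away from
the doubled cube. -/
theorem abs_pairing_le_of_disjoint_right {K : (Fin n → ℝ) → (Fin n → ℝ) → ℝ}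
    (hK : IsMeasurableKernel K) {T : ((Fin n → ℝ) → ℝ) → ((Fin n → ℝ) → ℝ)}
    (hTK : IsRepresentedBy T K) {A : ℝ≥0}
    (hA : ∀ (c : Fin n → ℝ) (l : ℝ), 0 < l →
      ∀ y ∈ cube c (2⁻¹ * l), ∀ y' ∈ cube c (2⁻¹ * l),
        ∫⁻ x in (cube c l)ᶜ, ‖K x y - K x y'‖ₑ ≤ A)
    {c : Fin n → ℝ} {l : ℝ} (hl : 0 < l) {a h : (Fin n → ℝ) → ℝ} (ha : IsLinftyc a)
    (haQ : ∀ x ∉ cube c l, a x = 0) (ha0 : ∫ x, a x = 0)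
    (hhQ : ∀ x ∈ cube c (2 * l), h x = 0) {α β : ℝ} (hα : 0 ≤ α) (hβ : 0 ≤ β)
    (haα : ∀ᵐ x, |a x| ≤ α) (hhβ : ∀ᵐ x, |h x| ≤ β) :
    |pairing T a h| ≤ A * α * β * l ^ n := by
  have hQ := measurableSet_cube c hl.le
  have hB : MeasurableSet (cube c (2 * l)) := measurableSet_cube c (by positivity)
  have hsupp : tsupport a ⊆ cube c l :=
    closure_minimal (Function.support_subset_iff'.2 haQ) (isCompact_cube c hl.le).isClosed
  have hQB : cube c l ⊆ cube c (2 * l) := fun x hx i => (hx i).trans (by linarith)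
  have hcQ : c ∈ cube c l := fun i => by rw [sub_self, abs_zero]; positivity
  have hpt : ∀ᵐ x, x ∈ (cube c (2 * l))ᶜ →
      ‖T a x * h x‖ₑ ≤ ∫⁻ y in cube c l, ‖K x y - K x c‖ₑ * ENNReal.ofReal (α * β) := by
    filter_upwards [hTK a ha, hhβ] with x hx hxβ hxB
    obtain ⟨hi, he⟩ := hx fun hxs => hxB (hQB (hsupp hxs))
    -- Since `a` has mean zero, `K x c` may be subtracted from the kernel.
    have h1 : T a x = ∫ y in cube c l, (K x y - K x c) * a y := by
      rw [setIntegral_eq_integral_of_forall_compl_eq_zero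
        fun y hy => by rw [haQ y hy, mul_zero]]
      simp only [sub_mul]
      rw [integral_sub hi (ha.integrable.const_mul _), integral_const_mul, ha0, mul_zero,
        sub_zero, he]
    rw [h1, ← integral_mul_const]
    refine (enorm_integral_le_lintegral_enorm _).trans (lintegral_mono_ae ?_)
    filter_upwards [ae_restrict_of_ae haα] with y hy
    rw [mul_assoc, enorm_mul]
    gcongr
    rw [Real.enorm_eq_ofReal_abs, abs_mul]
    exact ENNReal.ofReal_le_ofReal (mul_le_mul hy hxβ (abs_nonneg _) hα)
  have hmeas : AEMeasurable (Function.uncurry fun x y => ‖K x y - K x c‖ₑ * ENNReal.ofReal (α * β))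
      ((volume.restrict (cube c (2 * l))ᶜ).prod (volume.restrict (cube c l))) := by
    rw [Measure.prod_restrict]
    refine AEMeasurable.restrict ?_
    have h1 : AEStronglyMeasurable (fun p : (Fin n → ℝ) × (Fin n → ℝ) => K p.1 c)
        (volume.prod volume) := (hK.right c).comp_fst
    exact ((hK.joint.sub h1).enorm).mul_const _
  have hfin : ‖pairing T a h‖ₑ ≤ ENNReal.ofReal (A * α * β * l ^ n) := by
    rw [pairing, ← setIntegral_eq_integral_of_forall_compl_eq_zero (s := (cube c (2 * l))ᶜ)
      fun x hx => by rw [hhQ x (not_not.1 hx), mul_zero]]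
    calc ‖∫ x in (cube c (2 * l))ᶜ, T a x * h x‖ₑ
        ≤ ∫⁻ x in (cube c (2 * l))ᶜ, ‖T a x * h x‖ₑ := enorm_integral_le_lintegral_enorm _
      _ ≤ ∫⁻ x in (cube c (2 * l))ᶜ, ∫⁻ y in cube c l,
            ‖K x y - K x c‖ₑ * ENNReal.ofReal (α * β) :=
          lintegral_mono_ae ((ae_restrict_iff' hB.compl).2 hpt)
      _ = ∫⁻ y in cube c l, ∫⁻ x in (cube c (2 * l))ᶜ,
            ‖K x y - K x c‖ₑ * ENNReal.ofReal (α * β) := lintegral_lintegral_swap hmeas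
      _ ≤ ∫⁻ y in cube c l, A * ENNReal.ofReal (α * β) := by
          refine setLIntegral_mono' hQ fun y hy => ?_
          rw [lintegral_mul_const' _ _ ENNReal.ofReal_ne_top]
          gcongr
          -- The Hörmander condition is used for the doubled cube, whose concentric half is the cube
          -- carrying `a`.
          refine hA c (2 * l) (by positivity) y ?_ c ?_ <;>
            rwa [inv_mul_cancel_left₀ two_ne_zero]
      _ = ENNReal.ofReal (A * α * β * l ^ n) := by
          rw [setLIntegral_const, volume_cube c hl.le, mul_assoc (A : ℝ),
            ENNReal.ofReal_mul (p := A * (α * β)) (by positivity), ENNReal.ofReal_mul A.coe_nonneg,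
            ENNReal.ofReal_coe_nnreal]
  rw [Real.enorm_eq_ofReal_abs] at hfin
  exact (ENNReal.ofReal_le_ofReal_iff (by positivity)).1 hfin

/-- `T` maps a bounded function vanishing on a doubled cube to a function of bounded oscillation
on the cube. -/
theorem abs_pairing_le_of_disjoint_left {K : (Fin n → ℝ) → (Fin n → ℝ) → ℝ}
    {T : ((Fin n → ℝ) → ℝ) → ((Fin n → ℝ) → ℝ)} (hT : IsLinearOperator T)
    (hTK : IsRepresentedBy T K) {A : ℝ≥0}
    (hA : ∀ (c : Fin n → ℝ) (l : ℝ), 0 < l →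
      ∀ x ∈ cube c (2⁻¹ * l), ∀ x' ∈ cube c (2⁻¹ * l),
        ∫⁻ y in (cube c l)ᶜ, ‖K x y - K x' y‖ₑ ≤ A)
    {c : Fin n → ℝ} {l : ℝ} (hl : 0 < l) {a h : (Fin n → ℝ) → ℝ} (ha : IsLinftyc a)
    (haQ : ∀ x ∉ cube c l, a x = 0) (ha0 : ∫ x, a x = 0) (hh : IsLinftyc h)
    (hhQ : ∀ x ∈ cube c (2 * l), h x = 0) {α β : ℝ} (hβ : 0 ≤ β)
    (haα : ∀ᵐ x, |a x| ≤ α) (hhβ : ∀ᵐ x, |h x| ≤ β) :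
    |pairing T h a| ≤ A * α * β * l ^ n := by
  have hQ := measurableSet_cube c hl.le
  have hvol : volume (cube c l) ≠ 0 := by
    rw [volume_cube c hl.le, Ne, ENNReal.ofReal_eq_zero, not_le]; positivity
  have hsupp : ∀ x ∈ cube c l, x ∉ tsupport h := by
    intro x hx hxs
    -- Closing the support can only add boundary points of the doubled cube, which stay away from
    -- the inner cube.
    have h1 : tsupport h ⊆ (Metric.ball c l)ᶜ := by
      refine closure_minimal (Function.support_subset_iff'.2 fun y hy => hhQ y ?_)
        Metric.isOpen_ball.isClosed_compl
      rw [cube_eq_closedBall c (by positivity), mul_div_cancel_left₀ l two_ne_zero]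
      exact Metric.ball_subset_closedBall (not_not.1 hy)
    refine h1 hxs ?_
    rw [cube_eq_closedBall c hl.le] at hx
    exact Metric.closedBall_subset_ball (by linarith) hx
  have hgood : ∀ᵐ x, x ∈ cube c l →
      Integrable (fun y => K x y * h y) volume ∧ T h x = ∫ y, K x y * h y := by
    filter_upwards [hTK h hh] with x hx hxQ using hx (hsupp x hxQ)
  -- The kernel integral is only known to converge almost everywhere, so the centre may be a bad
  -- reference point; a cube of positive measure contains a good one.
  obtain ⟨x₀, hx₀Q, hx₀⟩ : ∃ x₀ ∈ cube c l, Integrable (fun y => K x₀ y * h y) volume := by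
    by_contra! hcon
    refine hvol (measure_mono_null (fun x hx => ?_) (ae_iff.1 hgood))
    exact fun hx' => hcon x hx (hx' hx).1
  set κ := ∫ y, K x₀ y * h y
  have hTh := hT.locallyIntegrable h hh
  have e : pairing T h a = ∫ x in cube c l, (T h x - κ) * a x := by
    rw [setIntegral_eq_integral_of_forall_compl_eq_zero fun y hy => by rw [haQ y hy, mul_zero]]
    simp only [sub_mul]
    rw [integral_sub (ha.integrable_mul' hTh) (ha.integrable.const_mul _), integral_const_mul,
      ha0, mul_zero, sub_zero, pairing]
  have hosc : ∀ᵐ x, x ∈ cube c l → |T h x - κ| ≤ A * β := by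
    filter_upwards [hgood] with x hx hxQ
    obtain ⟨hi, he⟩ := hx hxQ
    have h1 : T h x - κ = ∫ y in (cube c (2 * l))ᶜ, (K x y - K x₀ y) * h y := by
      rw [setIntegral_eq_integral_of_forall_compl_eq_zero
        fun y hy => by rw [hhQ y (not_not.1 hy), mul_zero]]
      simp only [sub_mul]
      rw [integral_sub hi hx₀, he]
    have h2 : ‖T h x - κ‖ₑ ≤ ENNReal.ofReal (A * β) := by
      rw [h1]
      calc ‖∫ y in (cube c (2 * l))ᶜ, (K x y - K x₀ y) * h y‖ₑ
          ≤ ∫⁻ y in (cube c (2 * l))ᶜ, ‖(K x y - K x₀ y) * h y‖ₑ :=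
            enorm_integral_le_lintegral_enorm _
        _ ≤ ∫⁻ y in (cube c (2 * l))ᶜ, ‖K x y - K x₀ y‖ₑ * ENNReal.ofReal β := by
            refine lintegral_mono_ae ?_
            filter_upwards [ae_restrict_of_ae hhβ] with y hy
            rw [enorm_mul]
            gcongr
            rw [Real.enorm_eq_ofReal_abs]
            exact ENNReal.ofReal_le_ofReal hy
        _ ≤ A * ENNReal.ofReal β := by
            rw [lintegral_mul_const' _ _ ENNReal.ofReal_ne_top]
            gcongr
            refine hA c (2 * l) (by positivity) x ?_ x₀ ?_ <;>
              rwa [inv_mul_cancel_left₀ two_ne_zero]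
        _ = ENNReal.ofReal (A * β) := by
            rw [ENNReal.ofReal_mul A.coe_nonneg, ENNReal.ofReal_coe_nnreal]
    rw [Real.enorm_eq_ofReal_abs] at h2
    exact (ENNReal.ofReal_le_ofReal_iff (by positivity)).1 h2
  rw [e, ← Real.norm_eq_abs]
  refine (norm_setIntegral_le_of_norm_le_const_ae' (C := A * β * α)
    (isCompact_cube c hl.le).measure_lt_top ?_).trans (le_of_eq ?_)
  · filter_upwards [hosc, haα] with x hx hxα hxQ
    rw [norm_mul]
    exact mul_le_mul (hx hxQ) hxα (norm_nonneg _) (by positivity)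
  · rw [measureReal_def, toReal_volume_cube c hl.le]; ring

/-! ### Bounds for `T h` and `T* h` against atoms. -/

/-- The functional `a ↦ ∫ a G` is bounded by `M` on the atoms of the Hardy space. -/
def AtomBound (G : (Fin n → ℝ) → ℝ) (M : ℝ) : Prop :=
  ∀ (c : Fin n → ℝ) (l : ℝ), 0 < l → ∀ a : (Fin n → ℝ) → ℝ, IsLinftyc a →
    (∀ x ∉ cube c l, a x = 0) → ∫ x, a x = 0 → ∀ α : ℝ, 0 ≤ α → (∀ᵐ x, |a x| ≤ α) →
      |∫ x, a x * G x| ≤ M * α * l ^ n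

/-- Inside the doubled cube local testing applies, with `|2Q| = 2 ^ n |Q|`. Outside it, smoothness
of `K` in the first variable serves `T h` and smoothness in the second serves `T* h`. -/
theorem LocallyTested.atomBound {K : (Fin n → ℝ) → (Fin n → ℝ) → ℝ}
    (hK : IsMeasurableKernel K) {T Tstar : ((Fin n → ℝ) → ℝ) → ((Fin n → ℝ) → ℝ)}
    (hT : IsLinearOperator T) (hTK : IsRepresentedBy T K) (hTstar : IsTranspose T Tstar)
    {r s : ℝ≥0∞} (hr : 1 ≤ r) (hs : 1 ≤ s) (hKr : HormanderClass r K)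
    (hKs : HormanderClass s fun x y => K y x) {D : ℝ} (hD : LocallyTested T D) :
    ∃ M : ℝ, ∀ (h : (Fin n → ℝ) → ℝ) (β : ℝ), IsLinftyc h → 0 ≤ β → (∀ᵐ x, |h x| ≤ β) →
      AtomBound (T h) (M * β) ∧ AtomBound (Tstar h) (M * β) := by
  obtain ⟨A, hA⟩ := hKr.exists_setLIntegral_le hr hK.left
  obtain ⟨A', hA'⟩ := hKs.exists_setLIntegral_le hs hK.right
  refine ⟨D * 2 ^ n + max A A', fun h β hh hβ hhβ => ?_⟩
  have hloc : ∀ c l, 0 < l → IsLinftyc ((cube c (2 * l)).indicator h) := fun c l hl =>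
    hh.indicator (measurableSet_cube c (by positivity))
  have hab : ∀ c l, ∀ᵐ x, |(cube c (2 * l)).indicator h x| ≤ β ∧
      |(h - (cube c (2 * l)).indicator h) x| ≤ β := by
    intro c l
    filter_upwards [hhβ] with x hx
    by_cases hxB : x ∈ cube c (2 * l) <;> simp [hxB, hβ, hx]
  have hz : ∀ c l x, x ∈ cube c (2 * l) → (h - (cube c (2 * l)).indicator h) x = 0 := by
    intro c l x hx
    simp [hx]
  have hQB : ∀ (c : Fin n → ℝ) l, 0 < l → cube c l ⊆ cube c (2 * l) :=
    fun c l hl x hx i => (hx i).trans (by linarith)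
  constructor
  · intro c l hl a ha haQ ha0 α hα haα
    have e : ∫ x, a x * T h x = pairing T h a := by simp only [pairing, mul_comm]
    have e2 := pairing_sub_left hT hh (hloc c l hl) ha
    have h1 := hD c (2 * l) (by positivity) _ a (hloc c l hl) ha
      (fun x hx => indicator_of_notMem hx _) (fun x hx => haQ x fun hx' => hx (hQB c l hl hx'))
      β α hβ hα ((hab c l).mono fun _ h => h.1) haα
    have h2 := abs_pairing_le_of_disjoint_left hT hTK hA hl ha haQ ha0 (hh.sub (hloc c l hl))
      (hz c l) hβ haα ((hab c l).mono fun _ h => h.2)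
    have h3 : (A : ℝ) * α * β * l ^ n ≤ max (A : ℝ) A' * α * β * l ^ n := by
      gcongr; exact le_max_left _ _
    rw [e]
    rw [mul_pow] at h1
    have h4 := abs_add_le (pairing T ((cube c (2 * l)).indicator h) a)
      (pairing T (h - (cube c (2 * l)).indicator h) a)
    rw [e2, add_sub_cancel] at h4
    rw [e2] at h2
    calc _ ≤ _ := h4
      _ ≤ D * β * α * (2 ^ n * l ^ n) + max (A : ℝ) A' * α * β * l ^ n :=
        add_le_add h1 (h2.trans h3)
      _ = _ := by push_cast; ring
  · intro c l hl a ha haQ ha0 α hα haα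
    have e : ∫ x, a x * Tstar h x = pairing T a h := (pairing_eq_transpose hTstar ha hh).symm
    have e2 := pairing_sub_right hT hh (hloc c l hl) ha
    have h1 := hD c (2 * l) (by positivity) a _ ha (hloc c l hl)
      (fun x hx => haQ x fun hx' => hx (hQB c l hl hx')) (fun x hx => indicator_of_notMem hx _)
      α β hα hβ haα ((hab c l).mono fun _ h => h.1)
    have h2 := abs_pairing_le_of_disjoint_right hK hTK hA' hl ha haQ ha0
      (hz c l) hα hβ haα ((hab c l).mono fun _ h => h.2)
    have h3 : (A' : ℝ) * α * β * l ^ n ≤ max (A : ℝ) A' * α * β * l ^ n := by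
      gcongr; exact le_max_right _ _
    rw [e]
    rw [mul_pow] at h1
    have h4 := abs_add_le (pairing T a ((cube c (2 * l)).indicator h))
      (pairing T a (h - (cube c (2 * l)).indicator h))
    rw [e2, add_sub_cancel] at h4
    rw [e2] at h2
    calc _ ≤ _ := h4
      _ ≤ D * α * β * (2 ^ n * l ^ n) + max (A : ℝ) A' * α * β * l ^ n :=
        add_le_add h1 (h2.trans h3)
      _ = _ := by push_cast; ring

/-- An atom bound extends to countable sums of atoms supported in disjoint dyadic cubes. -/
theorem AtomBound.abs_integral_mul_le {G : (Fin n → ℝ) → ℝ} (hG : LocallyIntegrable G volume)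
    {M : ℝ} (hM : AtomBound G M) {L : ℝ} (hL : 0 < L) {f : (Fin n → ℝ) → ℝ} {t : ℝ}
    (hfin : volume (⋃ σ, stopCell L f t σ) ≠ ∞) {a : (Fin n → ℝ) → ℝ} (ha : IsLinftyc a)
    (hsupp : ∀ x ∉ ⋃ σ, stopCell L f t σ, a x = 0)
    (h0 : ∀ σ, ∫ x in stopCell L f t σ, a x = 0) {α : ℝ} (hα : 0 ≤ α) (haα : ∀ᵐ x, |a x| ≤ α) :
    |∫ x, a x * G x| ≤ M * α * volume.real (⋃ σ, stopCell L f t σ) := by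
  have hm := measurableSet_stopCell L f t
  have h1 := hasSum_integral_iUnion (μ := volume) hm (pairwise_disjoint_stopCell L f t)
    (f := fun x => a x * G x) (ha.integrable_mul hG).integrableOn
  have h2 := hasSum_integral_iUnion (μ := volume) hm (pairwise_disjoint_stopCell L f t)
    (f := fun _ => M * α) (integrableOn_const hfin)
  simp only [setIntegral_const, smul_eq_mul] at h2
  rw [setIntegral_eq_integral_of_forall_compl_eq_zero
    fun x hx => by rw [hsupp x hx, zero_mul]] at h1
  rw [mul_comm, ← h1.tsum_eq, ← Real.norm_eq_abs]
  refine tsum_of_norm_bounded h2 fun σ => ?_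
  rcases (stopCell L f t σ).eq_empty_or_nonempty with h | ⟨x, hx⟩
  · simp [h]
  have hcell := stopCell_eq_of_mem hx
  have hind : ∫ x in stopCell L f t σ, a x * G x
      = ∫ x, (stopCell L f t σ).indicator a x * G x := by
    rw [← integral_indicator (hm σ)]
    refine integral_congr_ae (Eventually.of_forall fun x => ?_)
    by_cases hx : x ∈ stopCell L f t σ <;> simp [hx]
  have hbound := hM (cellCenter L σ.1 σ.2) (L / 2 ^ σ.1) (by positivity)
    ((stopCell L f t σ).indicator a) (ha.indicator (hm σ))
    (fun y hy => indicator_of_notMem (fun hy' => hy (dyadicCell_subset_cube hL _ _ hy'.1)) _)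
    (by rw [integral_indicator (hm σ), h0]) α hα (by
      filter_upwards [haα] with y hy
      by_cases hyc : y ∈ stopCell L f t σ <;> simp [hyc, hα, hy])
  rw [hind, Real.norm_eq_abs]
  rwa [hcell, volume_real_dyadicCell hL, mul_comm, ← hcell]

theorem AtomBound.mono {G : (Fin n → ℝ) → ℝ} {M M' : ℝ} (hM : AtomBound G M) (h : M ≤ M') :
    AtomBound G M' := by
  intro c l hl a ha haQ ha0 α hα haα
  refine (hM c l hl a ha haQ ha0 α hα haα).trans ?_
  gcongr

/-! ### Good parts at the heights `2 ^ k`. -/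

section GoodPart

variable {L : ℝ} {f : (Fin n → ℝ) → ℝ} {B : ℝ}

theorem isLinftyc_of_measurable (hL : 0 < L) (hf : Measurable f) (hB : ∀ x, |f x| ≤ B)
    (hbox : ∀ x ∉ dyadicBox n L, f x = 0) : IsLinftyc f :=
  IsLinftyc.of_bounded hf.aestronglyMeasurable (Eventually.of_forall hB) (c := 0) (l := 2 * L)
    (by positivity) fun x hx => hbox x fun h => hx (dyadicBox_subset_cube hL h)

theorem isLinftyc_goodPart (hL : 0 < L) (hf : Measurable f) (hB : ∀ x, |f x| ≤ B)
    (hbox : ∀ x ∉ dyadicBox n L, f x = 0) {t : ℝ} (ht : 0 ≤ t) : IsLinftyc (goodPart L f t) :=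
  isLinftyc_of_measurable hL (measurable_goodPart hf t) (abs_goodPart_le hL hf hB t)
    fun _ hx => goodPart_eq_zero hbox ht hx

theorem ae_abs_goodPart_two_pow_le (hL : 0 < L) (hf : Measurable f) (hB : ∀ x, |f x| ≤ B)
    (hbox : ∀ x ∉ dyadicBox n L, f x = 0) (hf2 : ∫ x, f x ^ 2 ≤ L ^ n) (k : ℕ) :
    ∀ᵐ x, |goodPart L f (2 ^ k) x| ≤ 2 ^ n * 2 ^ k :=
  ae_abs_goodPart_le hL hf hB (by positivity) fun x =>
    (cellAvg_zero_le_one hL hf hB hbox hf2 x).trans (one_le_pow₀ one_le_two)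

/-- The difference of the good parts at consecutive dyadic heights is a sum of atoms. -/
theorem AtomBound.abs_integral_goodPart_sub_mul_le {G : (Fin n → ℝ) → ℝ}
    (hG : LocallyIntegrable G volume) {M : ℝ} (hM : AtomBound G M) (hL : 0 < L)
    (hf : Measurable f) (hB : ∀ x, |f x| ≤ B) (hbox : ∀ x ∉ dyadicBox n L, f x = 0)
    (hf2 : ∫ x, f x ^ 2 ≤ L ^ n) (k : ℕ) :
    |∫ x, (goodPart L f (2 ^ (k + 1)) - goodPart L f (2 ^ k)) x * G x|
      ≤ M * (2 ^ n * (3 * 2 ^ k)) * volume.real (⋃ σ, stopCell L f (2 ^ k) σ) := by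
  have hle : (2 : ℝ) ^ k ≤ 2 ^ (k + 1) := pow_le_pow_right₀ one_le_two k.le_succ
  refine hM.abs_integral_mul_le hG hL
    (measure_ne_top_of_subset (iUnion_stopCell_subset hbox (by positivity))
      (volume_dyadicBox_ne_top hL))
    ((isLinftyc_goodPart hL hf hB hbox (by positivity)).sub
      (isLinftyc_goodPart hL hf hB hbox (by positivity)))
    (fun x hx => by rw [Pi.sub_apply, goodPart_eq_goodPart_of_notMem hle hx, sub_self])
    (fun σ => setIntegral_stopCell_goodPart_sub hL hf hB hle σ) (by positivity) ?_
  filter_upwards [ae_abs_goodPart_two_pow_le hL hf hB hbox hf2 k,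
    ae_abs_goodPart_two_pow_le hL hf hB hbox hf2 (k + 1)] with x h1 h2
  refine (abs_sub _ _).trans ((add_le_add h2 h1).trans (le_of_eq ?_))
  ring

end GoodPart

/-! ### The bilinear estimate by telescoping over heights. -/

section Main

variable {T Tstar : ((Fin n → ℝ) → ℝ) → ((Fin n → ℝ) → ℝ)}

theorem abs_pairing_le_of_normalized (hT : IsLinearOperator T) (hTstar : IsTranspose T Tstar)
    {D : ℝ} (hD : LocallyTested T D) {M : ℝ} (hM0 : 0 ≤ M)
    (hM : ∀ (h : (Fin n → ℝ) → ℝ) (β : ℝ), IsLinftyc h → 0 ≤ β → (∀ᵐ x, |h x| ≤ β) →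
      AtomBound (T h) (M * β) ∧ AtomBound (Tstar h) (M * β))
    {L : ℝ} (hL : 0 < L) {f h : (Fin n → ℝ) → ℝ} {Bf Bh : ℝ}
    (hf : Measurable f) (hBf : ∀ x, |f x| ≤ Bf) (hfbox : ∀ x ∉ dyadicBox n L, f x = 0)
    (hf2 : ∫ x, f x ^ 2 ≤ L ^ n)
    (hh : Measurable h) (hBh : ∀ x, |h x| ≤ Bh) (hhbox : ∀ x ∉ dyadicBox n L, h x = 0)
    (hh2 : ∫ x, h x ^ 2 ≤ L ^ n) :
    |pairing T f h| ≤ (D * 8 ^ n + 72 * M * 4 ^ n) * L ^ n := by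
  have hFc : ∀ k : ℕ, IsLinftyc (goodPart L f (2 ^ k)) := fun k =>
    isLinftyc_goodPart hL hf hBf hfbox (by positivity)
  have hHc : ∀ k : ℕ, IsLinftyc (goodPart L h (2 ^ k)) := fun k =>
    isLinftyc_goodPart hL hh hBh hhbox (by positivity)
  have hFb := ae_abs_goodPart_two_pow_le hL hf hBf hfbox hf2
  have hHb := ae_abs_goodPart_two_pow_le hL hh hBh hhbox hh2
  have hF0 : ∀ k : ℕ, ∀ x ∉ cube 0 (2 * L), goodPart L f (2 ^ k) x = 0 := fun k x hx =>
    goodPart_eq_zero hfbox (by positivity) fun h => hx (dyadicBox_subset_cube hL h)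
  have hH0 : ∀ k : ℕ, ∀ x ∉ cube 0 (2 * L), goodPart L h (2 ^ k) x = 0 := fun k x hx =>
    goodPart_eq_zero hhbox (by positivity) fun h => hx (dyadicBox_subset_cube hL h)
  -- Both good parts are at most `2 ^ n`, and the enclosing cube has volume `2 ^ n * L ^ n`; hence
  -- `8 ^ n`.
  have hbase : |pairing T (goodPart L f (2 ^ 0)) (goodPart L h (2 ^ 0))| ≤ D * 8 ^ n * L ^ n := by
    refine (hD 0 (2 * L) (by positivity) _ _ (hFc 0) (hHc 0) (hF0 0) (hH0 0) _ _ (by positivity)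
      (by positivity) (hFb 0) (hHb 0)).trans (le_of_eq ?_)
    rw [mul_pow, show (8 : ℝ) = 2 * 2 * 2 by norm_num, mul_pow, mul_pow]
    ring
  -- Change `f` first, then `h`. The jumps are at most `2 ^ n * (3 * 2 ^ k)`; they are paired with
  -- images of functions bounded by `2 ^ n * 2 ^ (k + 1)` and `2 ^ n * 2 ^ k`, which gives the
  -- factors `6` and `3`.
  have hstep : ∀ k : ℕ, |pairing T (goodPart L f (2 ^ (k + 1))) (goodPart L h (2 ^ (k + 1)))
      - pairing T (goodPart L f (2 ^ k)) (goodPart L h (2 ^ k))|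
      ≤ 6 * M * 4 ^ n * (4 ^ k * volume.real (⋃ σ, stopCell L f (2 ^ k) σ))
        + 3 * M * 4 ^ n * (4 ^ k * volume.real (⋃ σ, stopCell L h (2 ^ k) σ)) := by
    intro k
    have e1 := pairing_sub_left hT (hFc (k + 1)) (hFc k) (hHc (k + 1))
    have e2 := pairing_sub_right hT (hHc (k + 1)) (hHc k) (hFc k)
    have b1 := (hM _ _ (hHc (k + 1)) (by positivity)
      (hHb (k + 1))).2.abs_integral_goodPart_sub_mul_le (hTstar.locallyIntegrable _ (hHc (k + 1)))
      hL hf hBf hfbox hf2 k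
    have b2 := (hM _ _ (hFc k) (by positivity)
      (hFb k)).1.abs_integral_goodPart_sub_mul_le (hT.locallyIntegrable _ (hFc k))
      hL hh hBh hhbox hh2 k
    rw [← pairing_eq_transpose hTstar ((hFc (k + 1)).sub (hFc k)) (hHc (k + 1)), e1] at b1
    simp only [mul_comm _ (T (goodPart L f (2 ^ k)) _)] at b2
    change |pairing T _ _| ≤ _ at b2
    rw [e2] at b2
    have h4k : (4 : ℝ) ^ k = 2 ^ k * 2 ^ k := by rw [← mul_pow]; norm_num
    have h4n : (4 : ℝ) ^ n = 2 ^ n * 2 ^ n := by rw [← mul_pow]; norm_num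
    have h3 := (abs_sub_le _ (pairing T (goodPart L f (2 ^ k)) (goodPart L h (2 ^ (k + 1)))) _).trans
      (add_le_add b1 b2)
    refine h3.trans (le_of_eq ?_)
    rw [h4k, h4n]
    ring
  have hsum : ∀ N : ℕ, |pairing T (goodPart L f (2 ^ N)) (goodPart L h (2 ^ N))|
      ≤ D * 8 ^ n * L ^ n + ∑ k ∈ Finset.range N,
        (6 * M * 4 ^ n * (4 ^ k * volume.real (⋃ σ, stopCell L f (2 ^ k) σ))
        + 3 * M * 4 ^ n * (4 ^ k * volume.real (⋃ σ, stopCell L h (2 ^ k) σ))) := by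
    intro N
    induction N with
    | zero => simpa using hbase
    | succ N ih =>
      rw [Finset.sum_range_succ, ← add_assoc]
      have h1 := abs_add_le (pairing T (goodPart L f (2 ^ N)) (goodPart L h (2 ^ N)))
        (pairing T (goodPart L f (2 ^ (N + 1))) (goodPart L h (2 ^ (N + 1)))
          - pairing T (goodPart L f (2 ^ N)) (goodPart L h (2 ^ N)))
      rw [add_sub_cancel] at h1
      exact h1.trans (add_le_add ih (hstep N))
  -- Above the sup norms nothing stops, so the telescoping sum is finite and ends at `f` and `h`
  -- themselves.
  obtain ⟨N, hN⟩ := pow_unbounded_of_one_lt (max Bf Bh) (one_lt_two (α := ℝ))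
  have hfin := hsum N
  rw [goodPart_eq_self hL hf hBf ((le_max_left _ _).trans hN.le),
    goodPart_eq_self hL hh hBh ((le_max_right _ _).trans hN.le), Finset.sum_add_distrib,
    ← Finset.mul_sum, ← Finset.mul_sum] at hfin
  have s1 := (sum_four_pow_mul_volume_le hL hf hBf hfbox N).trans
    (mul_le_mul_of_nonneg_left hf2 (by norm_num))
  have s2 := (sum_four_pow_mul_volume_le hL hh hBh hhbox N).trans
    (mul_le_mul_of_nonneg_left hh2 (by norm_num))
  calc _ ≤ _ := hfin
    _ ≤ D * 8 ^ n * L ^ n + (6 * M * 4 ^ n * (8 * L ^ n) + 3 * M * 4 ^ n * (8 * L ^ n)) := by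
        gcongr
    _ = _ := by ring

theorem integral_sq_pos_or_ae_eq_zero {f : (Fin n → ℝ) → ℝ} (hf : IsLinftyc f) :
    0 < ∫ x, f x ^ 2 ∨ f =ᵐ[volume] 0 := by
  have h0 : 0 ≤ ∫ x, f x ^ 2 := integral_nonneg fun x => sq_nonneg _
  rcases h0.lt_or_eq with h | h
  · exact Or.inl h
  · right
    have h1 := (integral_eq_zero_iff_of_nonneg (fun x => sq_nonneg (f x))
      hf.memLp_two.integrable_sq).1 h.symm
    filter_upwards [h1] with x hx
    exact pow_eq_zero_iff two_ne_zero |>.1 hx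

/-- The decomposition needs a measurable, everywhere bounded representative, obtained by truncation.
Every large `L` is allowed, so that two functions can share one box. -/
theorem IsLinftyc.exists_measurable_ae_eq {f : (Fin n → ℝ) → ℝ} (hf : IsLinftyc f) :
    ∃ R : ℝ, 0 < R ∧ ∀ L, R ≤ L → ∃ (g : (Fin n → ℝ) → ℝ) (B : ℝ), Measurable g ∧
      (∀ x, |g x| ≤ B) ∧ (∀ x ∉ dyadicBox n L, g x = 0) ∧ g =ᵐ[volume] f := by
  obtain ⟨B, hB0, hB⟩ := hf.exists_bound
  obtain ⟨R, hR0, hR⟩ := hf.compact.isCompact.isBounded.subset_ball_lt 0 0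
  refine ⟨R, hR0, fun L hL => ?_⟩
  have hLpos : 0 < L := hR0.trans_le hL
  have hbox : MeasurableSet (dyadicBox n L) := measurable_dyadicIndex L 0 (MeasurableSet.of_discrete)
  let F := hf.aestronglyMeasurable.mk f
  have hF : Measurable F := hf.aestronglyMeasurable.stronglyMeasurable_mk.measurable
  refine ⟨(dyadicBox n L).indicator fun x => max (-B) (min B (F x)), B,
    (measurable_const.max (measurable_const.min hF)).indicator hbox, fun x => ?_,
    fun x hx => indicator_of_notMem hx _, ?_⟩
  · by_cases hx : x ∈ dyadicBox n L
    · rw [indicator_of_mem hx, abs_le]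
      exact ⟨le_max_left _ _, max_le (by linarith) (min_le_left _ _)⟩
    · rw [indicator_of_notMem hx, abs_zero]; exact hB0
  · filter_upwards [hB, hf.aestronglyMeasurable.ae_eq_mk] with x hx hxF
    by_cases hxb : x ∈ dyadicBox n L
    · rw [indicator_of_mem hxb, show F x = f x from hxF.symm, min_eq_right (abs_le.1 hx).2,
        max_eq_right (abs_le.1 hx).1]
    · rw [indicator_of_notMem hxb]
      refine (image_eq_zero_of_notMem_tsupport fun hxs => hxb ?_).symm
      rw [mem_dyadicBox hLpos]
      intro i
      have h1 := (norm_le_pi_norm x i).trans (mem_ball_zero_iff.1 (hR hxs)).le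
      have h2 := mem_ball_zero_iff.1 (hR hxs)
      have h3 := (norm_le_pi_norm x i).trans_lt h2
      rw [Real.norm_eq_abs, abs_lt] at h3
      constructor <;> linarith [h3.1, h3.2]

/-- Unless one function vanishes almost everywhere, both can be rescaled to have squared `L²` norm
exactly `L ^ n`; undoing the scaling cancels `L`. -/
theorem exists_abs_pairing_le (hT : IsLinearOperator T) (hTstar : IsTranspose T Tstar)
    {D : ℝ} (hD : LocallyTested T D) {M : ℝ} (hM0 : 0 ≤ M)
    (hM : ∀ (h : (Fin n → ℝ) → ℝ) (β : ℝ), IsLinftyc h → 0 ≤ β → (∀ᵐ x, |h x| ≤ β) →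
      AtomBound (T h) (M * β) ∧ AtomBound (Tstar h) (M * β))
    {f h : (Fin n → ℝ) → ℝ} (hf : IsLinftyc f) (hh : IsLinftyc h) :
    |pairing T f h| ≤ (D * 8 ^ n + 72 * M * 4 ^ n) * √(∫ x, f x ^ 2) * √(∫ x, h x ^ 2) := by
  rcases integral_sq_pos_or_ae_eq_zero hf with hfpos | hf0
  swap
  · have : pairing T f h = 0 := by
      rw [pairing_eq_transpose hTstar hf hh]
      refine integral_eq_zero_of_ae ?_
      filter_upwards [hf0] with x hx
      simp [hx]
    have h2 : ∫ x, f x ^ 2 = 0 := by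
      refine integral_eq_zero_of_ae ?_
      filter_upwards [hf0] with x hx
      simp [hx]
    simp [this, h2]
  rcases integral_sq_pos_or_ae_eq_zero hh with hhpos | hh0
  swap
  · have : pairing T f h = 0 := by
      refine integral_eq_zero_of_ae ?_
      filter_upwards [hh0] with x hx
      simp [hx]
    have h2 : ∫ x, h x ^ 2 = 0 := by
      refine integral_eq_zero_of_ae ?_
      filter_upwards [hh0] with x hx
      simp [hx]
    simp [this, h2]
  obtain ⟨R, hR0, hR⟩ := hf.exists_measurable_ae_eq
  obtain ⟨R', -, hR'⟩ := hh.exists_measurable_ae_eq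
  set L := max R R'
  have hL : 0 < L := hR0.trans_le (le_max_left _ _)
  obtain ⟨f', Bf, hf', hBf, hfbox, hff'⟩ := hR L (le_max_left _ _)
  obtain ⟨h', Bh, hh', hBh, hhbox, hhh'⟩ := hR' L (le_max_right _ _)
  have hf'c := isLinftyc_of_measurable hL hf' hBf hfbox
  have hh'c := isLinftyc_of_measurable hL hh' hBh hhbox
  have hfi : ∫ x, f x ^ 2 = ∫ x, f' x ^ 2 :=
    integral_congr_ae (hff'.mono fun x hx => by simp only [hx])
  have hhi : ∫ x, h x ^ 2 = ∫ x, h' x ^ 2 :=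
    integral_congr_ae (hhh'.mono fun x hx => by simp only [hx])
  rw [← pairing_congr_left hT hf'c hf hff', ← pairing_congr_right hhh', hfi, hhi]
  rw [hfi] at hfpos
  rw [hhi] at hhpos
  set I := ∫ x, f' x ^ 2
  set J := ∫ x, h' x ^ 2
  have hscale : ∀ (g : (Fin n → ℝ) → ℝ) (s : ℝ), ∫ x, (s • g) x ^ 2 = s ^ 2 * ∫ x, g x ^ 2 := by
    intro g s
    rw [← integral_const_mul]
    refine integral_congr_ae (Eventually.of_forall fun x => ?_)
    simp only [Pi.smul_apply, smul_eq_mul, mul_pow]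
  have hbnd : ∀ (g : (Fin n → ℝ) → ℝ) (s B : ℝ), (∀ x, |g x| ≤ B) → ∀ x, |(s • g) x| ≤ |s| * B := by
    intro g s B hB x
    rw [Pi.smul_apply, smul_eq_mul, abs_mul]
    exact mul_le_mul_of_nonneg_left (hB x) (abs_nonneg _)
  have hLn : 0 < L ^ n := by positivity
  have hs : ∀ I : ℝ, 0 < I → √(L ^ n / I) ^ 2 * I = L ^ n := by
    intro I hI
    rw [Real.sq_sqrt (by positivity), div_mul_cancel₀ _ hI.ne']
  have key := abs_pairing_le_of_normalized hT hTstar hD hM0 hM hL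
    (f := √(L ^ n / I) • f') (h := √(L ^ n / J) • h')
    (hf'.const_smul _) (hbnd f' _ Bf hBf) (fun x hx => by simp [hfbox x hx])
    (by rw [hscale, hs I hfpos])
    (hh'.const_smul _) (hbnd h' _ Bh hBh) (fun x hx => by simp [hhbox x hx])
    (by rw [hscale, hs J hhpos])
  rw [pairing_smul_left hT hf'c, pairing_smul_right, Real.sqrt_div hLn.le, Real.sqrt_div hLn.le,
    ← mul_assoc, abs_mul, abs_of_nonneg (by positivity)] at key
  have hI : 0 < √I := Real.sqrt_pos.2 hfpos
  have hJ : 0 < √J := Real.sqrt_pos.2 hhpos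
  have e : √(L ^ n) / √I * (√(L ^ n) / √J) = L ^ n / (√I * √J) := by
    rw [div_mul_div_comm, Real.mul_self_sqrt hLn.le]
  rw [e, div_mul_eq_mul_div, div_le_iff₀ (by positivity)] at key
  refine le_of_mul_le_mul_left ?_ hLn
  linarith

/-! ### From the bounded form to an operator on `L²`. -/

theorem eLpNorm_two_eq {f : (Fin n → ℝ) → ℝ} (hf : MemLp f 2 volume) :
    eLpNorm f 2 volume = ENNReal.ofReal √(∫ x, f x ^ 2) := by
  rw [hf.eLpNorm_eq_integral_rpow_norm two_ne_zero ENNReal.ofNat_ne_top, Real.sqrt_eq_rpow]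
  simp

/-- An operator whose bilinear form is bounded on `L²` maps `L^∞_c` to `L²`. -/
theorem eLpNorm_le_of_abs_pairing_le (hT : IsLinearOperator T) {C : ℝ} (hC : 0 ≤ C)
    {f : (Fin n → ℝ) → ℝ} (hf : IsLinftyc f)
    (hpair : ∀ h, IsLinftyc h → |pairing T f h| ≤ C * √(∫ x, f x ^ 2) * √(∫ x, h x ^ 2)) :
    eLpNorm (T f) 2 volume ≤ ENNReal.ofReal C * eLpNorm f 2 volume := by
  have hTf := (hT.locallyIntegrable f hf).aestronglyMeasurable
  let F := hTf.mk (T f)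
  have hF : Measurable F := hTf.stronglyMeasurable_mk.measurable
  -- `T f` is not yet known to be in `L²`, so it is tested against its own truncations, which are in
  -- `L^∞_c`; Fatou's lemma then removes the truncation.
  let S : ℕ → Set (Fin n → ℝ) := fun R => cube 0 R ∩ {x | |F x| ≤ R}
  have hS : ∀ R, MeasurableSet (S R) := fun R =>
    (measurableSet_cube 0 (Nat.cast_nonneg R)).inter (measurableSet_le hF.abs measurable_const)
  have hloc : ∀ R, IsLinftyc ((S R).indicator F) := by
    intro R
    refine IsLinftyc.of_bounded (α := R) (c := 0) (l := R)
      (hF.indicator (hS R)).aestronglyMeasurable (Eventually.of_forall fun x => ?_)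
      (Nat.cast_nonneg R) fun x hx => indicator_of_notMem (fun h => hx h.1) _
    by_cases hx : x ∈ S R
    · rw [indicator_of_mem hx]; exact hx.2
    · rw [indicator_of_notMem hx, abs_zero]; exact Nat.cast_nonneg R
  have hnorm : ∀ R, eLpNorm ((S R).indicator F) 2 volume
      ≤ ENNReal.ofReal C * eLpNorm f 2 volume := by
    intro R
    rw [eLpNorm_two_eq (hloc R).memLp_two, eLpNorm_two_eq hf.memLp_two, ← ENNReal.ofReal_mul hC]
    refine ENNReal.ofReal_le_ofReal ?_
    have h1 : pairing T f ((S R).indicator F) = ∫ x, (S R).indicator F x ^ 2 := by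
      refine integral_congr_ae ?_
      filter_upwards [hTf.ae_eq_mk] with x hx
      rw [hx]
      by_cases hxS : x ∈ S R
      · rw [indicator_of_mem hxS, sq]
      · rw [indicator_of_notMem hxS]; ring
    have h2 := hpair _ (hloc R)
    rw [h1] at h2
    have h3 : 0 ≤ ∫ x, (S R).indicator F x ^ 2 := integral_nonneg fun x => sq_nonneg _
    rw [abs_of_nonneg h3] at h2
    -- With `X` the squared norm of the truncation, the form bound reads `X ≤ C ‖f‖₂ √X`; divide by
    -- `√X`.
    rcases h3.lt_or_eq with h | h
    · refine le_of_mul_le_mul_right ?_ (Real.sqrt_pos.2 h)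
      rwa [Real.mul_self_sqrt h3]
    · rw [← h, Real.sqrt_zero]; positivity
  rw [eLpNorm_congr_ae hTf.ae_eq_mk]
  refine (Lp.eLpNorm_lim_le_liminf_eLpNorm
    (fun R => (hF.indicator (hS R)).aestronglyMeasurable) F
    (Eventually.of_forall fun x => ?_)).trans ?_
  · refine tendsto_const_nhds.congr' ?_
    obtain ⟨N, hN⟩ := exists_nat_ge (max (2 * ‖x‖) |F x|)
    filter_upwards [eventually_ge_atTop N] with R hR
    have hNR : (N : ℝ) ≤ R := by exact_mod_cast hR
    rw [indicator_of_mem]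
    refine ⟨fun i => ?_, (le_max_right _ _).trans (hN.trans hNR)⟩
    have h1 := norm_le_pi_norm x i
    rw [Real.norm_eq_abs] at h1
    have h2 := (le_max_left _ _).trans (hN.trans hNR)
    rw [Pi.zero_apply, sub_zero]
    linarith
  · exact (liminf_le_liminf (Eventually.of_forall hnorm)).trans (liminf_const _).le

/-- The space `L^∞_c`. -/
def linftyc (n : ℕ) : Submodule ℝ ((Fin n → ℝ) → ℝ) where
  carrier := {f | IsLinftyc f}
  add_mem' hf hg := hf.add hg
  zero_mem' := ⟨MemLp.zero, HasCompactSupport.zero⟩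
  smul_mem' a _ hf := hf.smul a

/-- The inclusion of `L^∞_c` into `L²`. -/
noncomputable def linftycToLp (n : ℕ) :
    linftyc n →ₗ[ℝ] Lp ℝ 2 (volume : Measure (Fin n → ℝ)) where
  toFun f := (IsLinftyc.memLp_two f.2).toLp f
  map_add' _ _ := rfl
  map_smul' _ _ := rfl

theorem denseRange_linftycToLp (n : ℕ) : DenseRange (linftycToLp n) := by
  rw [Metric.denseRange_iff]
  intro u ε hε
  have hε' : ENNReal.ofReal (ε / 2) ≠ 0 := by
    rw [Ne, ENNReal.ofReal_eq_zero, not_le]; positivity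
  obtain ⟨g, hgc, hug, hgcont, hg2⟩ :=
    (Lp.memLp u).exists_hasCompactSupport_eLpNorm_sub_le ENNReal.ofNat_ne_top hε'
  have hg : IsLinftyc g :=
    ⟨hgcont.memLp_top_of_hasCompactSupport hgc volume, hgc⟩
  refine ⟨⟨g, hg⟩, ?_⟩
  have h1 : dist u (hg.memLp_two.toLp g) ≤ ε / 2 := by
    rw [dist_eq_norm, Lp.norm_def]
    refine ENNReal.toReal_le_of_le_ofReal (by positivity) (le_trans (le_of_eq ?_) hug)
    refine eLpNorm_congr_ae ((Lp.coeFn_sub _ _).trans ?_)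
    exact EventuallyEq.rfl.sub hg.memLp_two.coeFn_toLp
  exact h1.trans_lt (by linarith)

theorem hasBoundedL2Extension_of_eLpNorm_le (hT : IsLinearOperator T) {C : ℝ} (hC0 : 0 ≤ C)
    (hC : ∀ f, IsLinftyc f → eLpNorm (T f) 2 volume ≤ ENNReal.ofReal C * eLpNorm f 2 volume) :
    HasBoundedL2Extension T := by
  have hmem : ∀ f, IsLinftyc f → MemLp (T f) 2 volume := fun f hf =>
    ⟨(hT.locallyIntegrable f hf).aestronglyMeasurable,
      (hC f hf).trans_lt (ENNReal.mul_lt_top ENNReal.ofReal_lt_top hf.memLp_two.2)⟩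
  let Φ : linftyc n →ₗ[ℝ] Lp ℝ 2 (volume : Measure (Fin n → ℝ)) :=
    { toFun := fun f => (hmem f f.2).toLp (T f)
      map_add' := fun f g => by
        rw [← MemLp.toLp_add]
        exact MemLp.toLp_congr _ _ (hT.add f g f.2 g.2)
      map_smul' := fun a f => by
        rw [RingHom.id_apply, ← MemLp.toLp_const_smul]
        exact MemLp.toLp_congr _ _ (hT.smul a f f.2) }
  have hΦ : ∀ f, ‖Φ f‖ ≤ C * ‖linftycToLp n f‖ := by
    intro f
    have h1 : ‖Φ f‖ = (eLpNorm (T f) 2 volume).toReal := Lp.norm_toLp _ (hmem f f.2)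
    have h2 : ‖linftycToLp n f‖ = (eLpNorm (f : (Fin n → ℝ) → ℝ) 2 volume).toReal :=
      Lp.norm_toLp _ (IsLinftyc.memLp_two f.2)
    rw [h1, h2, ← ENNReal.toReal_ofReal hC0, ← ENNReal.toReal_mul]
    exact ENNReal.toReal_mono
      (ENNReal.mul_ne_top ENNReal.ofReal_ne_top (IsLinftyc.memLp_two f.2).2.ne) (hC f f.2)
  refine ⟨Φ.extendOfNorm (linftycToLp n), fun f hf => ?_⟩
  have h := LinearMap.extendOfNorm_eq (denseRange_linftycToLp n) ⟨C, hΦ⟩ ⟨f, hf⟩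
  have h' : Φ.extendOfNorm (linftycToLp n) (hf.memLp_two.toLp f) = (hmem f hf).toLp (T f) := h
  rw [h']
  exact (hmem f hf).coeFn_toLp

/-! ### Necessity of the testing condition. -/

/-- The left side is `⟨T s, χ_E⟩`, where `s` is the sign of `T* χ_E` cut off to the cube. Both `s`
and `χ_E` have `L²` norm at most `|Q|^{1/2}`. -/
theorem setIntegral_abs_transpose_indicator_le (hTstar : IsTranspose T Tstar)
    {S : Lp ℝ 2 (volume : Measure (Fin n → ℝ)) →L[ℝ] Lp ℝ 2 (volume : Measure (Fin n → ℝ))}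
    (hS : ∀ (f : (Fin n → ℝ) → ℝ) (hf : IsLinftyc f), S (hf.memLp_two.toLp f) =ᵐ[volume] T f)
    (c : Fin n → ℝ) {l : ℝ} (hl : 0 < l) {E : Set (Fin n → ℝ)} (hE : MeasurableSet E)
    (hEQ : E ⊆ cube c l) :
    ∫ x in cube c l, |Tstar (E.indicator 1) x| ≤ ‖S‖ * (volume (cube c l)).toReal := by
  have hQ := measurableSet_cube c hl.le
  have hnorm : ∀ (f : (Fin n → ℝ) → ℝ) (hf : IsLinftyc f), (∀ᵐ x, |f x| ≤ 1) →
      (∀ x ∉ cube c l, f x = 0) → ‖hf.memLp_two.toLp f‖ ≤ √((volume (cube c l)).toReal) := by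
    intro f hf hf1 hfQ
    rw [Lp.norm_toLp, eLpNorm_two_eq hf.memLp_two, ENNReal.toReal_ofReal (Real.sqrt_nonneg _)]
    refine Real.sqrt_le_sqrt ?_
    rw [← setIntegral_eq_integral_of_forall_compl_eq_zero (s := cube c l)
      fun x hx => by rw [hfQ x hx, zero_pow two_ne_zero]]
    have hfin : volume (cube c l) ≠ ∞ := (isCompact_cube c hl.le).measure_lt_top.ne
    calc ∫ x in cube c l, f x ^ 2 ≤ ∫ x in cube c l, (1 : ℝ) := by
          refine integral_mono_ae hf.memLp_two.integrable_sq.integrableOn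
            (integrableOn_const hfin) ?_
          filter_upwards [ae_restrict_of_ae hf1] with x hx
          rw [← sq_abs]
          exact pow_le_one₀ (abs_nonneg _) hx
      _ = _ := by simp [measureReal_def]
  have hEc : IsLinftyc (E.indicator (1 : (Fin n → ℝ) → ℝ)) ∧
      ∀ᵐ x, |E.indicator (1 : (Fin n → ℝ) → ℝ) x| ≤ 1 := by
    have hb : ∀ x, |E.indicator (1 : (Fin n → ℝ) → ℝ) x| ≤ 1 := fun x => by
      by_cases hx : x ∈ E <;> simp [hx]
    exact ⟨IsLinftyc.of_bounded (stronglyMeasurable_one.indicator hE).aestronglyMeasurable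
      (Eventually.of_forall hb) hl.le fun x hx => indicator_of_notMem (fun h => hx (hEQ h)) _,
      Eventually.of_forall hb⟩
  obtain ⟨hEc, hE1⟩ := hEc
  have hloc := (hTstar.locallyIntegrable _ hEc).aestronglyMeasurable
  let G := hloc.mk (Tstar (E.indicator 1))
  have hG : Measurable G := hloc.stronglyMeasurable_mk.measurable
  let s : (Fin n → ℝ) → ℝ := (cube c l).indicator fun x => if 0 ≤ G x then 1 else -1
  have hs1 : ∀ x, |s x| ≤ 1 := by
    intro x
    by_cases hx : x ∈ cube c l
    · simp only [s, indicator_of_mem hx]; split_ifs <;> simp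
    · simp [s, hx]
  have hsQ : ∀ x ∉ cube c l, s x = 0 := fun x hx => indicator_of_notMem hx _
  have hs : IsLinftyc s := by
    refine IsLinftyc.of_bounded (Measurable.aestronglyMeasurable ?_)
      (Eventually.of_forall hs1) hl.le hsQ
    exact (Measurable.ite (measurableSet_le measurable_const hG) measurable_const
      measurable_const).indicator hQ
  have e : ∫ x in cube c l, |Tstar (E.indicator 1) x| = pairing T s (E.indicator 1) := by
    rw [pairing_eq_transpose hTstar hs hEc, ← integral_indicator hQ]
    refine integral_congr_ae ?_
    filter_upwards [hloc.ae_eq_mk] with x hx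
    by_cases hxQ : x ∈ cube c l
    · simp only [s, indicator_of_mem hxQ, hx]
      split_ifs with h0
      · rw [one_mul]; exact abs_of_nonneg h0
      · rw [neg_one_mul]; exact abs_of_neg (not_le.1 h0)
    · simp [s, hxQ]
  have e2 : pairing T s (E.indicator 1)
      = inner ℝ (hEc.memLp_two.toLp (E.indicator 1)) (S (hs.memLp_two.toLp s)) := by
    rw [L2.inner_def, pairing]
    refine integral_congr_ae ?_
    filter_upwards [hS s hs, hEc.memLp_two.coeFn_toLp] with x hx hx2
    rw [hx, hx2]
    simp
  rw [e, e2]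
  refine (real_inner_le_norm _ _).trans ?_
  have h1 := hnorm _ hEc hE1 fun x hx => indicator_of_notMem (fun h => hx (hEQ h)) _
  have h2 := hnorm s hs (Eventually.of_forall hs1) hsQ
  have h3 : 0 ≤ (volume (cube c l)).toReal := ENNReal.toReal_nonneg
  calc _ ≤ √((volume (cube c l)).toReal) * (‖S‖ * √((volume (cube c l)).toReal)) := by
        gcongr
        exact (S.le_opNorm _).trans (mul_le_mul_of_nonneg_left h2 (norm_nonneg _))
    _ = ‖S‖ * (√((volume (cube c l)).toReal) * √((volume (cube c l)).toReal)) := by ring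
    _ = _ := by rw [Real.mul_self_sqrt h3]

end Main

end SparseT1

theorem corollary4p3 {n : ℕ} (hn : 1 ≤ n)
    (K : (Fin n → ℝ) → (Fin n → ℝ) → ℝ) (hK : SparseT1.IsMeasurableKernel K)
    (T Tstar : ((Fin n → ℝ) → ℝ) → ((Fin n → ℝ) → ℝ))
    (hT : SparseT1.IsLinearOperator T)
    (hTK : SparseT1.IsRepresentedBy T K)
    (hTstar : SparseT1.IsTranspose T Tstar)
    (r : ℝ≥0∞) (hr : 1 < r)
    (hKr : SparseT1.HormanderClass r K)
    (hK1 : SparseT1.HormanderClass 1 (fun x y => K y x)) :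
    SparseT1.HasBoundedL2Extension T ↔
      ∃ C : ℝ, 0 < C ∧ ∀ (c : Fin n → ℝ) (l : ℝ), 0 < l →
        ∀ E : Set (Fin n → ℝ), MeasurableSet E → E ⊆ SparseT1.cube c l →
          ∫ x in SparseT1.cube c l, |Tstar (E.indicator 1) x| ≤
            C * (volume (SparseT1.cube c l)).toReal := by
  constructor
  · rintro ⟨S, hS⟩
    refine ⟨‖S‖ + 1, by positivity, fun c l hl E hE hEQ => ?_⟩
    refine (SparseT1.setIntegral_abs_transpose_indicator_le hTstar hS c hl hE hEQ).trans ?_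
    gcongr
    exact le_add_of_nonneg_right zero_le_one
  · rintro ⟨C, hC0, hC⟩
    have hD := SparseT1.locallyTested_of_indicator hT hTstar hC
    obtain ⟨M, hM⟩ := hD.atomBound hK hT hTK hTstar hr.le le_rfl hKr hK1
    -- The sign of `M` is not recorded; passing to `|M|` makes the final constant nonnegative.
    have hM' : ∀ (h : (Fin n → ℝ) → ℝ) (β : ℝ), SparseT1.IsLinftyc h → 0 ≤ β →
        (∀ᵐ x, |h x| ≤ β) →
        SparseT1.AtomBound (T h) (|M| * β) ∧ SparseT1.AtomBound (Tstar h) (|M| * β) :=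
      fun h β hh hβ hhβ =>
        have hle : M * β ≤ |M| * β := mul_le_mul_of_nonneg_right (le_abs_self M) hβ
        ⟨(hM h β hh hβ hhβ).1.mono hle, (hM h β hh hβ hhβ).2.mono hle⟩
    have hB : 0 ≤ 2 * C * 8 ^ n + 72 * |M| * 4 ^ n := by positivity
    exact SparseT1.hasBoundedL2Extension_of_eLpNorm_le hT hB fun f hf =>
      SparseT1.eLpNorm_le_of_abs_pairing_le hT hB hf fun h hh =>
        SparseT1.exists_abs_pairing_le hT hTstar hD (abs_nonneg M) hM' hf hh
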